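/- **Setting.** Consider $\dot x(t)=f(x(t),u(t))$, $x(0)=x_0$, with state $x(t)\in\mathbb R^{n}$, input $u(t)\in\mathcal U\subset\mathbb R^{m}$ and a set $\mathcal X\subset\mathbb R^n$ of initial states. Inputs are piecewise continuous and right-continuous functions of time with values in $\mathcal U$. Assume: * (C1) $f:\mathbb R^n\times\mathbb R^m\to\mathbb R^n$ is twice continuously differentiable; * (C2) $f(0,0)=0$; * (C3) $\mathcal U$ is closed and convex, and $0$ is an interior point of $\mathcal U$; * (C4) for every $x_0\in\mathcal X$ and every input $u:[0,\infty)\to\mathcal U$ the system has a unique solution on $[0,\infty)$; * (C5), (C6) the state is measured exactly, and there are no disturbances; * (C7) the linearization $\dot x=Ax+Bu$, $A=\frac{\partial f}{\partial x}(0,0)$, $B=\frac{\partial f}{\partial u}(0,0)$, is stabilizable; * for every $R$ there is $C$ with $\|f(x,u)\|\le C(1+\|u\|^2)$ for all $\|x\|\le R$ and $u\in\mathcal U$ (this is automatic if $\mathcal U$ is bounded, or if $f$ is affine in $u$). Let $W_x,W_u$ be symmetric positive definite, and write $A_K=A-BK$ and $Q^*=W_x+K^TW_uK$. **Terminal ingredients.**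 $K$, $\Delta Q$ and a symmetric positive definite $P$ are chosen in one of two ways. * (a) Arbitrary controller: all eigenvalues of $A_K$ have negative real part, $\Delta Q$ is positive definite and $A_K^TP+PA_K=-(Q^*+\Delta Q)$. * (b) LQR: for some $\widetilde W_x>W_x$ and $\widetilde W_u>W_u$ one has $K=\widetilde W_u^{-1}B^TP$, $A_K^TP+PA_K=-(\widetilde W_x+K^T\widetilde W_uK)$ and $\Delta Q=(\widetilde W_x-W_x)+K^T(\widetilde W_u-W_u)K$. The terminal region is $\Omega=\{x: x^TPx\le\alpha,\ -Kx\in\mathcal U\}$, where $\alpha>0$ is *admissible*: $-Kx\in\mathcal U$ whenever $x^TPx\le\alpha$, and $x^T\Delta Q\,x-2x^TP\,(f(x,-Kx)-A_Kx)\ge0$ for all $x\in\Omega$. **NMPC controller.** Let $0<\delta\le T_p<\infty$. For a measured state $x(t)$ the NMPC problem is to minimize $$\int_t^{t+T_p}\big(z(\tau)^TW_xz(\tau)+\bar u(\tau)^TW_u\bar u(\tau)\big)\,d\tau+z(t+T_p)^TPz(t+T_p)$$ over inputs $\bar u:[t,t+T_p]\to\mathcal U$, subject to $\dot z=f(z,\bar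 u)$ on $[t,t+T_p]$, $z(t)=x(t)$ and $z(t+T_p)\in\Omega$. Assume that it has a minimizer at every state at which it is feasible, and let the controller select one, $\bar u^*$. In closed loop, at each time $t=k\delta$, $k=0,1,2,\dots$, the state is measured, the problem is solved, and $u(\tau)=\bar u^*(\tau)$ is applied for $\tau\in[t,t+\delta)$. **Theorem.** Admissible $\alpha>0$ exist. For every admissible $\alpha$, the nominal closed-loop system is asymptotically stable at the origin, and all states at which the NMPC problem is feasible lie in the region of attraction. That is: * the set of feasible states is a neighbourhood of $0$; * from every initial state at which the problem is feasible at $t=0$, a closed-loop trajectory exists on $[0,\infty)$, and along every such trajectory the problem is feasible at all sampling instants $k\delta$ and $x(t)\to0$ as $t\to\infty$; * for every $\varepsilon>0$ there is $\eta>0$ such that $\|x_0\|<\eta$ implies $\|x(t)\|<\varepsilon$ for all $t\ge0$. -/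

import Mathlib

open Set Filter Topology
open scoped Matrix

namespace QIHNMPC

noncomputable section

/-- The Euclidean space `ℝⁿ` of column vectors. -/
abbrev Vec (n : ℕ) : Type := EuclideanSpace ℝ (Fin n)

/-- The matrix-vector product `M x`. -/
def mulV {n m : ℕ} (M : Matrix (Fin n) (Fin m) ℝ) (x : Vec m) : Vec n :=
  WithLp.toLp 2 (M *ᵥ WithLp.ofLp x)

/-- The quadratic form `xᵀ M x`. -/
def quad {n : ℕ} (M : Matrix (Fin n) (Fin n) ℝ) (x : Vec n) : ℝ :=
  inner ℝ x (mulV M x)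

/-! ### Inputs, solutions, linearization -/

/-- `u` is a piecewise continuous, right-continuous function on `[0, T]`: it is right-continuous,
has left limits, and has only finitely many discontinuities. -/
structure IsPiecewiseRightCont {m : ℕ} (u : ℝ → Vec m) (T : ℝ) : Prop where
  right_cont : ∀ t ∈ Ico 0 T, ContinuousWithinAt u (Ici t) t
  left_lim : ∀ t ∈ Ioc 0 T, ∃ l : Vec m, Tendsto u (𝓝[<] t) (𝓝 l)
  finite_disc : ∃ D : Finset ℝ, ∀ t ∈ Ioo 0 T, t ∉ D → ContinuousAt u t

/-- `u` is an admissible input on `[0, T]`: piecewise continuous, right-continuous, with values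
in the input constraint set `U`. -/
def IsAdmissible {m : ℕ} (U : Set (Vec m)) (u : ℝ → Vec m) (T : ℝ) : Prop :=
  IsPiecewiseRightCont u T ∧ ∀ t ∈ Icc 0 T, u t ∈ U

/-- `x` solves `dx/dt = f(x, u)` on `[0, T]`: it is continuous and at every time its right
derivative is `f(x(t), u(t))`. For a piecewise continuous, right-continuous `u` this is equivalent
to the integral equation, and the derivative is two-sided at every continuity point of `u`. -/
def IsSolutionOn {n m : ℕ} (f : Vec n → Vec m → Vec n) (u : ℝ → Vec m) (x : ℝ → Vec n)
    (T : ℝ) : Prop :=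
  ContinuousOn x (Icc 0 T) ∧
    ∀ t ∈ Ico 0 T, HasDerivWithinAt x (f (x t) (u t)) (Ici t) t

/-- `A = ∂f/∂x` at `(0, 0)`. -/
def jacX {n m : ℕ} (f : Vec n → Vec m → Vec n) : Matrix (Fin n) (Fin n) ℝ :=
  Matrix.of fun i j => (fderiv ℝ (fun x => f x 0) 0 (EuclideanSpace.single j 1)) i

/-- `B = ∂f/∂u` at `(0, 0)`. -/
def jacU {n m : ℕ} (f : Vec n → Vec m → Vec n) : Matrix (Fin n) (Fin m) ℝ :=
  Matrix.of fun i j => (fderiv ℝ (fun u => f 0 u) 0 (EuclideanSpace.single j 1)) i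

/-- All (complex) eigenvalues of the real matrix `M` have negative real part. -/
def IsHurwitz {n : ℕ} (M : Matrix (Fin n) (Fin n) ℝ) : Prop :=
  ∀ μ ∈ spectrum ℂ (M.map (fun r : ℝ => (r : ℂ))), μ.re < 0

/-- `A_K = A - B K`. -/
def closedA {n m : ℕ} (f : Vec n → Vec m → Vec n) (K : Matrix (Fin m) (Fin n) ℝ) :
    Matrix (Fin n) (Fin n) ℝ :=
  jacX f - jacU f * K

/-- The standing assumptions on the system `dx/dt = f(x, u)` with input constraint set `U` and
set `X` of initial states. That the state is measured exactly and that no disturbance acts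
is built into the definition of the closed loop below. -/
structure StandingAssumptions {n m : ℕ} (f : Vec n → Vec m → Vec n) (U : Set (Vec m))
    (X : Set (Vec n)) : Prop where
  smooth : ContDiff ℝ 2 (fun p : Vec n × Vec m => f p.1 p.2)
  equilibrium : f 0 0 = 0
  closed : IsClosed U
  convex : Convex ℝ U
  zero_mem_interior : (0 : Vec m) ∈ interior U
  wellPosed : ∀ x₀ ∈ X, ∀ u : ℝ → Vec m, (∀ T, IsAdmissible U u T) →
    ∃ x : ℝ → Vec n, (x 0 = x₀ ∧ ∀ T, IsSolutionOn f u x T) ∧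
      ∀ y : ℝ → Vec n, (y 0 = x₀ ∧ ∀ T, IsSolutionOn f u y T) → EqOn y x (Ici 0)
  stabilizable : ∃ K : Matrix (Fin m) (Fin n) ℝ, IsHurwitz (closedA f K)

/-- The dynamics grow at most quadratically in the input, locally uniformly in the state.
This is automatic if `U` is bounded, or if `f` is affine in `u`. -/
def QuadraticInputGrowth {n m : ℕ} (f : Vec n → Vec m → Vec n) (U : Set (Vec m)) : Prop :=
  ∀ R : ℝ, ∃ C : ℝ, ∀ x : Vec n, ‖x‖ ≤ R → ∀ u ∈ U, ‖f x u‖ ≤ C * (1 + ‖u‖ ^ 2)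

/-! ### Terminal ingredients -/

/-- `Q* = W_x + Kᵀ W_u K`. -/
def Qstar {n m : ℕ} (Wx : Matrix (Fin n) (Fin n) ℝ) (Wu : Matrix (Fin m) (Fin m) ℝ)
    (K : Matrix (Fin m) (Fin n) ℝ) : Matrix (Fin n) (Fin n) ℝ :=
  Wx + Kᵀ * Wu * K

/-- Arbitrary-controller design: `K` is stabilizing, `ΔQ` is positive definite and
`P` is the positive definite solution of `A_Kᵀ P + P A_K = -(Q* + ΔQ)`. -/
def IsArbitraryDesign {n m : ℕ} (f : Vec n → Vec m → Vec n)
    (Wx : Matrix (Fin n) (Fin n) ℝ) (Wu : Matrix (Fin m) (Fin m) ℝ)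
    (K : Matrix (Fin m) (Fin n) ℝ) (P ΔQ : Matrix (Fin n) (Fin n) ℝ) : Prop :=
  IsHurwitz (closedA f K) ∧ ΔQ.PosDef ∧ P.PosDef ∧
    (closedA f K)ᵀ * P + P * closedA f K = -(Qstar Wx Wu K + ΔQ)

/-- LQR design with weights `W̃_x > W_x`, `W̃_u > W_u`: `P` is positive definite,
`K = W̃_u⁻¹ Bᵀ P` and `A_Kᵀ P + P A_K = -(W̃_x + Kᵀ W̃_u K)`; here
`ΔQ = (W̃_x - W_x) + Kᵀ (W̃_u - W_u) K`. -/
def IsLQRDesign {n m : ℕ} (f : Vec n → Vec m → Vec n)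
    (Wx : Matrix (Fin n) (Fin n) ℝ) (Wu : Matrix (Fin m) (Fin m) ℝ)
    (K : Matrix (Fin m) (Fin n) ℝ) (P ΔQ : Matrix (Fin n) (Fin n) ℝ) : Prop :=
  ∃ (Wx' : Matrix (Fin n) (Fin n) ℝ) (Wu' : Matrix (Fin m) (Fin m) ℝ),
    (Wx' - Wx).PosDef ∧ (Wu' - Wu).PosDef ∧ P.PosDef ∧
    K = Wu'⁻¹ * (jacU f)ᵀ * P ∧
    (closedA f K)ᵀ * P + P * closedA f K = -(Wx' + Kᵀ * Wu' * K) ∧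
    ΔQ = (Wx' - Wx) + Kᵀ * (Wu' - Wu) * K

/-- The nonlinearity `Φ_K(x) = f(x, -K x) - A_K x`. -/
def PhiK {n m : ℕ} (f : Vec n → Vec m → Vec n) (K : Matrix (Fin m) (Fin n) ℝ) (x : Vec n) :
    Vec n :=
  f x (-mulV K x) - mulV (closedA f K) x

/-- `Ψ(x) = xᵀ ΔQ x - 2 xᵀ P Φ_K(x)`. -/
def Psi {n m : ℕ} (f : Vec n → Vec m → Vec n) (K : Matrix (Fin m) (Fin n) ℝ)
    (P ΔQ : Matrix (Fin n) (Fin n) ℝ) (x : Vec n) : ℝ :=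
  quad ΔQ x - 2 * inner ℝ x (mulV P (PhiK f K x))

/-- The terminal region `Ω = {x | xᵀ P x ≤ α, -K x ∈ U}`. -/
def terminalRegion {n m : ℕ} (U : Set (Vec m)) (K : Matrix (Fin m) (Fin n) ℝ)
    (P : Matrix (Fin n) (Fin n) ℝ) (α : ℝ) : Set (Vec n) :=
  {x | quad P x ≤ α ∧ -mulV K x ∈ U}

/-- `α` is an admissible level for the terminal region: `α > 0`, the local controller
`u = -K x` respects the input constraints on the ellipsoid `xᵀ P x ≤ α`, and `Ψ ≥ 0` on the
terminal region. -/
def IsTerminalLevel {n m : ℕ} (f : Vec n → Vec m → Vec n) (U : Set (Vec m))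
    (K : Matrix (Fin m) (Fin n) ℝ) (P ΔQ : Matrix (Fin n) (Fin n) ℝ) (α : ℝ) : Prop :=
  0 < α ∧ (∀ x : Vec n, quad P x ≤ α → -mulV K x ∈ U) ∧
    ∀ x ∈ terminalRegion U K P α, 0 ≤ Psi f K P ΔQ x

/-! ### The optimal control problem -/

/-- The data of the finite-horizon optimal control problem: dynamics, input constraint set,
stage and terminal weights, terminal region and prediction horizon. -/
structure OCP (n m : ℕ) where
  f : Vec n → Vec m → Vec n
  U : Set (Vec m)
  Wx : Matrix (Fin n) (Fin n) ℝ
  Wu : Matrix (Fin m) (Fin m) ℝ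
  P : Matrix (Fin n) (Fin n) ℝ
  Ω : Set (Vec n)
  Tp : ℝ

/-- The pair (input `u`, predicted state `z`) satisfies all constraints of the problem posed at
the measured state `x`. The system is time-invariant, so the horizon `[t, t + Tp]` is
written as `[0, Tp]`. -/
def OCP.IsFeasiblePair {n m : ℕ} (p : OCP n m) (x : Vec n) (u : ℝ → Vec m) (z : ℝ → Vec n) :
    Prop :=
  IsAdmissible p.U u p.Tp ∧ IsSolutionOn p.f u z p.Tp ∧ z 0 = x ∧ z p.Tp ∈ p.Ω

/-- The cost `∫ (zᵀ W_x z + uᵀ W_u u) dτ + z(Tp)ᵀ P z(Tp)`. -/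
def OCP.cost {n m : ℕ} (p : OCP n m) (u : ℝ → Vec m) (z : ℝ → Vec n) : ℝ :=
  (∫ τ in (0 : ℝ)..p.Tp, (quad p.Wx (z τ) + quad p.Wu (u τ))) + quad p.P (z p.Tp)

/-- The set of states at which the problem is feasible. -/
def OCP.feasibleSet {n m : ℕ} (p : OCP n m) : Set (Vec n) :=
  {x | ∃ u z, p.IsFeasiblePair x u z}

/-- `u` is an optimal input for the problem posed at the state `x`. -/
def OCP.IsOptimalInput {n m : ℕ} (p : OCP n m) (x : Vec n) (u : ℝ → Vec m) : Prop :=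
  ∃ z, p.IsFeasiblePair x u z ∧ ∀ v w, p.IsFeasiblePair x v w → p.cost u z ≤ p.cost v w

/-- `ctrl` is an NMPC controller: it assigns to every feasible state a solution of the optimal
control problem posed at that state. -/
def OCP.IsNMPCController {n m : ℕ} (p : OCP n m) (ctrl : Vec n → ℝ → Vec m) : Prop :=
  ∀ x ∈ p.feasibleSet, p.IsOptimalInput x (ctrl x)

/-! ### The closed loop -/

/-- `x` is a trajectory on `[0, ∞)` of the nominal system in closed loop with `ctrl`: at each
sampling instant `kδ` the state is measured and the initial piece, of length `δ`, of the input
`ctrl (x (kδ))` is applied until the next sampling instant. -/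
def IsClosedLoop {n m : ℕ} (f : Vec n → Vec m → Vec n) (ctrl : Vec n → ℝ → Vec m) (δ : ℝ)
    (x₀ : Vec n) (x : ℝ → Vec n) : Prop :=
  x 0 = x₀ ∧ ∃ u : ℝ → Vec m,
    (∀ k : ℕ, ∀ s ∈ Ico 0 δ, u (k * δ + s) = ctrl (x (k * δ)) s) ∧
    ∀ T, IsSolutionOn f u x T

/-- Asymptotic stability of the origin, with region of attraction containing `D`, for the
system whose trajectories from `x₀` are the functions `x` with `Traj x₀ x`: trajectories from
`D` exist, the origin is Lyapunov stable, `D` is a neighbourhood of the origin, and all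
trajectories from `D` converge to the origin. -/
structure IsAsymptoticallyStable {n : ℕ} (Traj : Vec n → (ℝ → Vec n) → Prop)
    (D : Set (Vec n)) : Prop where
  exists_traj : ∀ x₀ ∈ D, ∃ x, Traj x₀ x
  nhds : D ∈ 𝓝 (0 : Vec n)
  stable : ∀ ε > 0, ∃ η > 0, ∀ x₀ : Vec n, ‖x₀‖ < η → ∀ x, Traj x₀ x → ∀ t, 0 ≤ t → ‖x t‖ < ε
  attractive : ∀ x₀ ∈ D, ∀ x, Traj x₀ x → Tendsto x atTop (𝓝 0)

end

end QIHNMPC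

/-!
The optimal cost is a Lyapunov function of the closed loop.

Near the origin, `Φ_K(x) = o(‖x‖)`, so `Ψ ≥ 0` on a small ellipsoid (`exists_isTerminalLevel`).
On a terminal region, the Lyapunov equation and `Ψ ≥ 0` say that under `u = -K x` the function
`xᵀ P x` decreases at least as fast as the stage cost accumulates. Hence the local controller never
leaves the region, and its cost up to any time, plus the terminal cost there, is at most `xᵀ P x` at
the start (`IsNMPCSetup.exists_local_solution`). So the problem is feasible on the terminal region
with cost at most `xᵀ P x`, and a feasible pair whose first piece of length `δ` is dropped can be
prolonged by the local controller without increasing the cost of what is left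
(`IsNMPCSetup.exists_feasible_shift`).

By uniqueness of solutions the closed loop follows the optimal prediction between two sampling
instants. By induction over them, the problem stays feasible and the total stage cost along the
closed loop is at most the cost of any feasible pair at the initial state
(`IsNMPCSetup.closedLoop_invariant`).

Inputs need not be bounded, so convergence does not follow from a bound on the speed of the state.
Instead, in a shell `ε ≤ ‖x‖ ≤ 2ε` the speed is at most `κ` times the stage cost, because the
dynamics grow at most quadratically in the input and the stage cost is bounded below in the shell.
Crossing the shell therefore costs at least `ε / κ` (`norm_lt_two_mul_of_integral_lt`). If the total
cost is smaller than that, the state cannot cross: this gives stability, since the cost is at most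
`x₀ᵀ P x₀` near the origin. Applied to the tail of a trajectory of finite cost, it gives
convergence (`IsFiniteCostTrajectory.tendsto_zero`).
-/

namespace QIHNMPC

open MeasureTheory intervalIntegral

/-! ### Quadratic forms -/

/-- `x ↦ M x` as a continuous linear map. -/
noncomputable def mulVL {n m : ℕ} (M : Matrix (Fin n) (Fin m) ℝ) : Vec m →L[ℝ] Vec n :=
  LinearMap.toContinuousLinearMap (Matrix.toEuclideanLin M)

theorem mulVL_apply {n m : ℕ} (M : Matrix (Fin n) (Fin m) ℝ) (x : Vec m) :
    mulVL M x = mulV M x := rfl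

theorem continuous_mulV {n m : ℕ} (M : Matrix (Fin n) (Fin m) ℝ) : Continuous (mulV M) :=
  (mulVL M).continuous

theorem mulV_zero {n m : ℕ} (M : Matrix (Fin n) (Fin m) ℝ) : mulV M 0 = 0 :=
  (mulVL M).map_zero

theorem mulV_add {n m : ℕ} (M : Matrix (Fin n) (Fin m) ℝ) (x y : Vec m) :
    mulV M (x + y) = mulV M x + mulV M y := (mulVL M).map_add x y

theorem mulV_neg {n m : ℕ} (M : Matrix (Fin n) (Fin m) ℝ) (x : Vec m) :
    mulV M (-x) = -mulV M x := (mulVL M).map_neg x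

theorem mulV_smul {n m : ℕ} (M : Matrix (Fin n) (Fin m) ℝ) (c : ℝ) (x : Vec m) :
    mulV M (c • x) = c • mulV M x := (mulVL M).map_smul c x

theorem add_mulV {n m : ℕ} (M N : Matrix (Fin n) (Fin m) ℝ) (x : Vec m) :
    mulV (M + N) x = mulV M x + mulV N x := by
  simp [mulV, Matrix.add_mulVec]

theorem sub_mulV {n m : ℕ} (M N : Matrix (Fin n) (Fin m) ℝ) (x : Vec m) :
    mulV (M - N) x = mulV M x - mulV N x := by
  simp [mulV, Matrix.sub_mulVec]

theorem neg_mulV {n m : ℕ} (M : Matrix (Fin n) (Fin m) ℝ) (x : Vec m) :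
    mulV (-M) x = -mulV M x := by
  simp [mulV, Matrix.neg_mulVec]

theorem mul_mulV {n m k : ℕ} (M : Matrix (Fin n) (Fin m) ℝ) (N : Matrix (Fin m) (Fin k) ℝ)
    (x : Vec k) : mulV (M * N) x = mulV M (mulV N x) := by
  simp [mulV, Matrix.mulVec_mulVec]

theorem inner_mulV {n m : ℕ} (M : Matrix (Fin n) (Fin m) ℝ) (x : Vec n) (y : Vec m) :
    inner ℝ x (mulV M y) = inner ℝ (mulV Mᵀ x) y := by
  simp only [mulV, EuclideanSpace.inner_eq_star_dotProduct, star_trivial]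
  rw [dotProduct_comm, Matrix.dotProduct_mulVec, Matrix.mulVec_transpose, dotProduct_comm]

theorem continuous_quad {n : ℕ} (M : Matrix (Fin n) (Fin n) ℝ) : Continuous (quad M) :=
  continuous_id.inner (continuous_mulV M)

theorem quad_zero {n : ℕ} (M : Matrix (Fin n) (Fin n) ℝ) : quad M 0 = 0 := by
  simp [quad]

theorem quad_neg {n : ℕ} (M : Matrix (Fin n) (Fin n) ℝ) (x : Vec n) :
    quad M (-x) = quad M x := by
  simp [quad, mulV_neg]

theorem quad_smul {n : ℕ} (M : Matrix (Fin n) (Fin n) ℝ) (c : ℝ) (x : Vec n) :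
    quad M (c • x) = c ^ 2 * quad M x := by
  simp only [quad, mulV_smul, real_inner_smul_left, real_inner_smul_right]; ring

theorem add_quad {n : ℕ} (M N : Matrix (Fin n) (Fin n) ℝ) (x : Vec n) :
    quad (M + N) x = quad M x + quad N x := by
  simp [quad, add_mulV, inner_add_right]

theorem neg_quad {n : ℕ} (M : Matrix (Fin n) (Fin n) ℝ) (x : Vec n) :
    quad (-M) x = -quad M x := by
  simp [quad, neg_mulV]

theorem quad_conj {n m : ℕ} (W : Matrix (Fin m) (Fin m) ℝ) (K : Matrix (Fin m) (Fin n) ℝ)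
    (x : Vec n) : quad (Kᵀ * W * K) x = quad W (mulV K x) := by
  simp only [quad, mul_mulV]
  rw [inner_mulV, Matrix.transpose_transpose]

theorem quad_pos {n : ℕ} {M : Matrix (Fin n) (Fin n) ℝ} (hM : M.PosDef) {x : Vec n}
    (hx : x ≠ 0) : 0 < quad M x := by
  have h := hM.dotProduct_mulVec_pos (x := WithLp.ofLp x)
    (fun h => hx (by ext i; simpa using congrFun h i))
  simpa [quad, mulV, EuclideanSpace.inner_eq_star_dotProduct, dotProduct_comm] using h

theorem quad_nonneg {n : ℕ} {M : Matrix (Fin n) (Fin n) ℝ} (hM : M.PosDef) (x : Vec n) :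
    0 ≤ quad M x := by
  rcases eq_or_ne x 0 with rfl | hx
  · rw [quad_zero]
  · exact (quad_pos hM hx).le

theorem exists_mul_sq_le_quad {n : ℕ} {M : Matrix (Fin n) (Fin n) ℝ} (hM : M.PosDef) :
    ∃ c > 0, ∀ x : Vec n, c * ‖x‖ ^ 2 ≤ quad M x := by
  rcases (Metric.sphere (0 : Vec n) 1).eq_empty_or_nonempty with he | hne
  · refine ⟨1, one_pos, fun x => ?_⟩
    rcases eq_or_ne x 0 with rfl | hx
    · simp [quad_zero]
    · have : (‖x‖⁻¹ • x) ∈ Metric.sphere (0 : Vec n) 1 := by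
        simp [norm_smul, hx]
      simp [he] at this
  · obtain ⟨y, hy, hmin⟩ := (isCompact_sphere (0 : Vec n) 1).exists_isMinOn hne
      (continuous_quad M).continuousOn
    have hy0 : y ≠ 0 := by
      rintro rfl; simp at hy
    refine ⟨quad M y, quad_pos hM hy0, fun x => ?_⟩
    rcases eq_or_ne x 0 with rfl | hx
    · simp [quad_zero]
    · have hx' : (‖x‖⁻¹ • x) ∈ Metric.sphere (0 : Vec n) 1 := by
        simp [norm_smul, hx]
      have h := hmin hx'
      simp only [mem_ofPred_eq, quad_smul] at h
      have hpos : 0 < ‖x‖ ^ 2 := by positivity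
      rw [inv_pow, inv_mul_eq_div, le_div_iff₀ hpos] at h
      exact h

theorem hasDerivWithinAt_quad {n : ℕ} {P : Matrix (Fin n) (Fin n) ℝ} (hP : P.PosDef)
    {z : ℝ → Vec n} {v : Vec n} {s : Set ℝ} {t : ℝ} (hz : HasDerivWithinAt z v s t) :
    HasDerivWithinAt (fun τ => quad P (z τ)) (2 * inner ℝ (z t) (mulV P v)) s t := by
  have h1 : HasDerivWithinAt (fun τ => mulV P (z τ)) (mulV P v) s t :=
    (mulVL P).hasFDerivAt.comp_hasDerivWithinAt t hz
  have h2 := hz.inner ℝ h1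
  have hPt : Pᵀ = P := by simpa using hP.1.eq
  have h3 : inner ℝ v (mulV P (z t)) = inner ℝ (z t) (mulV P v) := by
    rw [inner_mulV, hPt, real_inner_comm]
  exact h2.congr_deriv (by rw [h3]; ring)

/-! ### The terminal region -/

/-- Both designs give a positive definite `ΔQ` and the Lyapunov equation
`A_Kᵀ P + P A_K = -(Q* + ΔQ)`: the common core of the two designs. -/
structure LyapunovDesign {n m : ℕ} (f : Vec n → Vec m → Vec n)
    (Wx : Matrix (Fin n) (Fin n) ℝ) (Wu : Matrix (Fin m) (Fin m) ℝ)
    (K : Matrix (Fin m) (Fin n) ℝ) (P ΔQ : Matrix (Fin n) (Fin n) ℝ) : Prop where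
  posDef_P : P.PosDef
  posDef_ΔQ : ΔQ.PosDef
  lyapunov : (closedA f K)ᵀ * P + P * closedA f K = -(Qstar Wx Wu K + ΔQ)

theorem lyapunovDesign_of_design {n m : ℕ} {f : Vec n → Vec m → Vec n}
    {Wx : Matrix (Fin n) (Fin n) ℝ} {Wu : Matrix (Fin m) (Fin m) ℝ}
    {K : Matrix (Fin m) (Fin n) ℝ} {P ΔQ : Matrix (Fin n) (Fin n) ℝ}
    (h : IsArbitraryDesign f Wx Wu K P ΔQ ∨ IsLQRDesign f Wx Wu K P ΔQ) :
    LyapunovDesign f Wx Wu K P ΔQ := by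
  rcases h with ⟨-, h1, h2, h3⟩ | ⟨Wx', Wu', h1, h2, h3, -, h5, rfl⟩
  · exact ⟨h2, h1, h3⟩
  · refine ⟨h3, h1.add_posSemidef ?_, ?_⟩
    · simpa using h2.posSemidef.conjTranspose_mul_mul_same K
    · rw [h5, Qstar]
      simp only [Matrix.mul_sub, Matrix.sub_mul]
      abel

/-- The derivative of `xᵀ P x` along `dx/dt = f(x, -K x)`. -/
theorem LyapunovDesign.two_inner_eq {n m : ℕ} {f : Vec n → Vec m → Vec n}
    {Wx : Matrix (Fin n) (Fin n) ℝ} {Wu : Matrix (Fin m) (Fin m) ℝ}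
    {K : Matrix (Fin m) (Fin n) ℝ} {P ΔQ : Matrix (Fin n) (Fin n) ℝ}
    (h : LyapunovDesign f Wx Wu K P ΔQ) (x : Vec n) :
    2 * inner ℝ x (mulV P (f x (-mulV K x))) = -quad (Qstar Wx Wu K) x - Psi f K P ΔQ x := by
  have h1 : quad ((closedA f K)ᵀ * P + P * closedA f K) x =
      2 * inner ℝ x (mulV P (mulV (closedA f K) x)) := by
    have hPt : Pᵀ = P := by simpa using h.posDef_P.1.eq
    have e : inner ℝ x (mulV ((closedA f K)ᵀ * P) x) =
        inner ℝ x (mulV P (mulV (closedA f K) x)) := by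
      rw [← mul_mulV, inner_mulV, Matrix.transpose_mul, Matrix.transpose_transpose, hPt,
        real_inner_comm]
    rw [add_quad]
    simp only [quad]
    rw [e, mul_mulV]; ring
  rw [h.lyapunov, neg_quad, add_quad] at h1
  have h2 : f x (-mulV K x) = mulV (closedA f K) x + PhiK f K x := by simp [PhiK]
  rw [h2, mulV_add, inner_add_right, Psi]
  linarith

/-- A matrix whose columns are the images of the standard basis vectors represents `L`; the
Jacobians `jacX` and `jacU` are defined by their entries. -/
theorem mulV_eq_of_single {n m : ℕ} (M : Matrix (Fin n) (Fin m) ℝ) (L : Vec m →L[ℝ] Vec n)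
    (h : ∀ i j, M i j = L (EuclideanSpace.single j 1) i) (x : Vec m) : mulV M x = L x := by
  have : (mulVL M) = L := by
    apply ContinuousLinearMap.coe_injective
    refine (EuclideanSpace.basisFun (Fin m) ℝ).toBasis.ext fun j => ?_
    ext i
    simp [mulVL_apply, mulV, h]
  rw [← this, mulVL_apply]

theorem hasFDerivAt_localLoop {n m : ℕ} {f : Vec n → Vec m → Vec n}
    (hf : ContDiff ℝ 2 (fun p : Vec n × Vec m => f p.1 p.2)) (K : Matrix (Fin m) (Fin n) ℝ) :
    HasFDerivAt (fun x => f x (-mulV K x)) (mulVL (closedA f K)) 0 := by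
  set F : Vec n × Vec m → Vec n := fun p => f p.1 p.2
  set L := fderiv ℝ F 0
  have hF : HasFDerivAt F L 0 := (hf.differentiable (by norm_num) 0).hasFDerivAt
  have hx : HasFDerivAt (fun x : Vec n => f x 0) (L.comp (ContinuousLinearMap.inl ℝ _ _)) 0 :=
    HasFDerivAt.comp (g := F) (f := fun x : Vec n => (x, (0 : Vec m))) 0 hF
      (hasFDerivAt_prodMk_left 0 0)
  have hu : HasFDerivAt (fun u : Vec m => f 0 u) (L.comp (ContinuousLinearMap.inr ℝ _ _)) 0 :=
    HasFDerivAt.comp (g := F) (f := fun u : Vec m => ((0 : Vec n), u)) 0 hF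
      (hasFDerivAt_prodMk_right 0 0)
  have hA : ∀ x, mulV (jacX f) x = L (x, 0) := fun x => by
    rw [mulV_eq_of_single (jacX f) (L.comp (ContinuousLinearMap.inl ℝ _ _))
      (fun i j => by rw [← hx.fderiv]; rfl) x]
    rfl
  have hB : ∀ u, mulV (jacU f) u = L (0, u) := fun u => by
    rw [mulV_eq_of_single (jacU f) (L.comp (ContinuousLinearMap.inr ℝ _ _))
      (fun i j => by rw [← hu.fderiv]; rfl) u]
    rfl
  have hin : HasFDerivAt (fun x : Vec n => (x, -mulV K x))
      ((ContinuousLinearMap.id ℝ (Vec n)).prod (-mulVL K)) 0 :=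
    (hasFDerivAt_id _).prodMk (mulVL K).hasFDerivAt.neg
  have hF' : HasFDerivAt F L ((0 : Vec n), -mulV K (0 : Vec n)) := by
    rw [mulV_zero, neg_zero]; exact hF
  have hc := HasFDerivAt.comp (g := F) (0 : Vec n) hF' hin
  refine hc.congr_fderiv (ContinuousLinearMap.ext fun x => Eq.symm ?_)
  change mulV (jacX f - jacU f * K) x = L (x, -mulV K x)
  rw [sub_mulV, mul_mulV, hA, hB, ← map_sub]
  simp

/-- `A_K` is the derivative of `x ↦ f(x, -K x)` at the origin. -/
theorem PhiK_isLittleO {n m : ℕ} {f : Vec n → Vec m → Vec n}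
    (hf : ContDiff ℝ 2 (fun p : Vec n × Vec m => f p.1 p.2)) (h0 : f 0 0 = 0)
    (K : Matrix (Fin m) (Fin n) ℝ) :
    (PhiK f K) =o[𝓝 0] (fun x : Vec n => x) := by
  have h := (hasFDerivAt_localLoop hf K).isLittleO
  simpa [mulV_zero, h0, mulVL_apply] using! h

theorem exists_isTerminalLevel {n m : ℕ} {f : Vec n → Vec m → Vec n} {U : Set (Vec m)}
    (hf : ContDiff ℝ 2 (fun p : Vec n × Vec m => f p.1 p.2)) (h0 : f 0 0 = 0)
    (hU : (0 : Vec m) ∈ interior U) (K : Matrix (Fin m) (Fin n) ℝ)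
    {P ΔQ : Matrix (Fin n) (Fin n) ℝ} (hP : P.PosDef) (hΔ : ΔQ.PosDef) :
    ∃ α : ℝ, IsTerminalLevel f U K P ΔQ α := by
  obtain ⟨c, hc, hcq⟩ := exists_mul_sq_le_quad hΔ
  obtain ⟨d, hd, hdq⟩ := exists_mul_sq_le_quad hP
  have hN : 0 < 2 * (‖mulVL P‖ + 1) := by positivity
  have h1 := (PhiK_isLittleO hf h0 K).def (div_pos hc hN)
  have h2 : ∀ᶠ x : Vec n in 𝓝 0, -mulV K x ∈ U := by
    have : Tendsto (fun x : Vec n => -mulV K x) (𝓝 0) (𝓝 0) := by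
      have h := (continuous_mulV K).fun_neg.tendsto (0 : Vec n)
      rwa [mulV_zero, neg_zero] at h
    exact this.eventually (mem_interior_iff_mem_nhds.1 hU)
  obtain ⟨r, hr, hball⟩ := Metric.eventually_nhds_iff.1 (h1.and h2)
  have hin : ∀ x : Vec n, quad P x ≤ d * (r / 2) ^ 2 → dist x 0 < r := fun x hx => by
    have := (hdq x).trans hx
    have h3 : ‖x‖ ^ 2 ≤ (r / 2) ^ 2 := le_of_mul_le_mul_left this hd
    have h4 := (sq_le_sq₀ (norm_nonneg x) (by positivity)).1 h3
    rw [dist_zero_right]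
    linarith
  refine ⟨d * (r / 2) ^ 2, by positivity, fun x hx => (hball (hin x hx)).2, fun x hx => ?_⟩
  have h3 := (hball (hin x hx.1)).1
  have h4 : inner ℝ x (mulV P (PhiK f K x)) ≤ ‖x‖ * ((‖mulVL P‖ + 1) * ‖PhiK f K x‖) := by
    refine (real_inner_le_norm _ _).trans ?_
    refine mul_le_mul_of_nonneg_left ?_ (norm_nonneg x)
    rw [← mulVL_apply]
    refine ((mulVL P).le_opNorm _).trans ?_
    exact mul_le_mul_of_nonneg_right (by linarith) (norm_nonneg _)
  have h5 : ‖x‖ * ((‖mulVL P‖ + 1) * ‖PhiK f K x‖) ≤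
      ‖x‖ * ((‖mulVL P‖ + 1) * (c / (2 * (‖mulVL P‖ + 1)) * ‖x‖)) :=
    mul_le_mul_of_nonneg_left (mul_le_mul_of_nonneg_left h3 (by positivity)) (norm_nonneg x)
  have h6 : ‖x‖ * ((‖mulVL P‖ + 1) * (c / (2 * (‖mulVL P‖ + 1)) * ‖x‖)) = c * ‖x‖ ^ 2 / 2 := by
    field_simp
  have := hcq x
  rw [Psi]
  linarith

/-! ### Piecewise continuous inputs -/

theorem IsPiecewiseRightCont.of_continuousOn {m : ℕ} {u : ℝ → Vec m} {T : ℝ}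
    (hu : ContinuousOn u (Icc 0 T)) : IsPiecewiseRightCont u T where
  right_cont t ht := (hu t (Ico_subset_Icc_self ht)).mono_of_mem_nhdsWithin
    (mem_of_superset (Ico_mem_nhdsGE ht.2) fun _ hs => ⟨ht.1.trans hs.1, hs.2.le⟩)
  left_lim t ht := ⟨u t, (hu t (Ioc_subset_Icc_self ht)).mono_of_mem_nhdsWithin
    (mem_of_superset (Ioo_mem_nhdsLT ht.1) fun _ hs => ⟨hs.1.le, hs.2.le.trans ht.2⟩)⟩
  finite_disc := ⟨∅, fun _ ht _ => hu.continuousAt (Icc_mem_nhds ht.1 ht.2)⟩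

theorem IsPiecewiseRightCont.mono {m : ℕ} {u : ℝ → Vec m} {T T' : ℝ}
    (hu : IsPiecewiseRightCont u T) (h : T' ≤ T) : IsPiecewiseRightCont u T' where
  right_cont t ht := hu.right_cont t ⟨ht.1, ht.2.trans_le h⟩
  left_lim t ht := hu.left_lim t ⟨ht.1, ht.2.trans h⟩
  finite_disc := hu.finite_disc.imp fun _ hD t ht => hD t ⟨ht.1, ht.2.trans_le h⟩

theorem tendsto_add_const_nhdsGE (t c : ℝ) : Tendsto (fun s => s + c) (𝓝[≥] t) (𝓝[≥] (t + c)) :=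
  ((continuous_add_const c).continuousWithinAt (s := Ici t) (x := t)).tendsto_nhdsWithin
    fun _ hs => add_le_add_left hs c

theorem tendsto_add_const_nhdsLT (t c : ℝ) : Tendsto (fun s => s + c) (𝓝[<] t) (𝓝[<] (t + c)) :=
  ((continuous_add_const c).continuousWithinAt (s := Iio t) (x := t)).tendsto_nhdsWithin
    fun _ hs => add_lt_add_left (mem_Iio.1 hs) c

theorem IsPiecewiseRightCont.shift {m : ℕ} {u : ℝ → Vec m} {T c : ℝ}
    (hu : IsPiecewiseRightCont u T) (hc : 0 ≤ c) :
    IsPiecewiseRightCont (fun s => u (s + c)) (T - c) where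
  right_cont t ht := (hu.right_cont (t + c) ⟨by linarith [ht.1], by linarith [ht.2]⟩).tendsto.comp
    (tendsto_add_const_nhdsGE t c)
  left_lim t ht := by
    obtain ⟨l, hl⟩ := hu.left_lim (t + c) ⟨by linarith [ht.1], by linarith [ht.2]⟩
    exact ⟨l, hl.comp (tendsto_add_const_nhdsLT t c)⟩
  finite_disc := by
    obtain ⟨D, hD⟩ := hu.finite_disc
    refine ⟨D.image (fun s => s - c), fun t ht htD => ?_⟩
    refine ContinuousAt.comp (f := fun s => s + c) (hD (t + c)
      ⟨by linarith [ht.1], by linarith [ht.2]⟩ fun h => htD ?_)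
      (continuous_add_const c).continuousAt
    exact Finset.mem_image.2 ⟨t + c, h, by ring⟩

/-- `u` up to (not including) time `c`, followed by `v` restarted at time `c`. -/
noncomputable def splice {E : Type*} (c : ℝ) (u v : ℝ → E) (s : ℝ) : E :=
  if s < c then u s else v (s - c)

theorem splice_of_lt {E : Type*} {c s : ℝ} (u v : ℝ → E) (h : s < c) : splice c u v s = u s :=
  if_pos h

theorem splice_of_ge {E : Type*} {c s : ℝ} (u v : ℝ → E) (h : c ≤ s) :
    splice c u v s = v (s - c) :=
  if_neg h.not_gt

theorem splice_add {E : Type*} (c : ℝ) {s : ℝ} (u v : ℝ → E) (h : 0 ≤ s) :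
    splice c u v (s + c) = v s := by
  rw [splice_of_ge u v (by linarith)]; congr 1; ring

theorem splice_eventuallyEq_left {E : Type*} {c t : ℝ} (u v : ℝ → E) (h : t < c) :
    splice c u v =ᶠ[𝓝 t] u :=
  mem_of_superset (Iio_mem_nhds h) fun _ hs => splice_of_lt u v hs

theorem splice_eventuallyEq_right {E : Type*} {c t : ℝ} (u v : ℝ → E) (h : c ≤ t) :
    splice c u v =ᶠ[𝓝[≥] t] fun s => v (s + -c) :=
  mem_of_superset self_mem_nhdsWithin fun _ hs =>
    (splice_of_ge u v (h.trans hs)).trans (by rw [sub_eq_add_neg])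

theorem IsPiecewiseRightCont.splice {m : ℕ} {u v : ℝ → Vec m} {c d : ℝ}
    (hu : IsPiecewiseRightCont u c) (hv : IsPiecewiseRightCont v d) :
    IsPiecewiseRightCont (splice c u v) (c + d) where
  right_cont t ht := by
    rcases lt_or_ge t c with h | h
    · exact (hu.right_cont t ⟨ht.1, h⟩).congr_of_eventuallyEq
        ((splice_eventuallyEq_left u v h).filter_mono nhdsWithin_le_nhds) (splice_of_lt u v h)
    · have h1 := (hv.right_cont (t + -c) ⟨by linarith, by linarith [ht.2]⟩).tendsto.comp
        (tendsto_add_const_nhdsGE t (-c))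
      refine ContinuousWithinAt.congr_of_eventuallyEq (f := fun s => v (s + -c)) h1
        (splice_eventuallyEq_right u v h) ?_
      rw [splice_of_ge u v h, sub_eq_add_neg]
  left_lim t ht := by
    rcases le_or_gt t c with h | h
    · obtain ⟨l, hl⟩ := hu.left_lim t ⟨ht.1, h⟩
      refine ⟨l, hl.congr' ?_⟩
      exact mem_of_superset self_mem_nhdsWithin fun s hs =>
        (splice_of_lt u v (lt_of_lt_of_le hs h)).symm
    · obtain ⟨l, hl⟩ := hv.left_lim (t + -c) ⟨by linarith, by linarith [ht.2]⟩
      refine ⟨l, (hl.comp (tendsto_add_const_nhdsLT t (-c))).congr' ?_⟩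
      filter_upwards [Ioo_mem_nhdsLT h] with s hs
      rw [splice_of_ge u v hs.1.le, sub_eq_add_neg]; rfl
  finite_disc := by
    obtain ⟨D, hD⟩ := hu.finite_disc
    obtain ⟨D', hD'⟩ := hv.finite_disc
    refine ⟨insert c (D ∪ D'.image (fun s => s + c)), fun t ht htD => ?_⟩
    simp only [Finset.mem_insert, Finset.mem_union, not_or] at htD
    rcases lt_or_gt_of_ne htD.1 with h | h
    · exact (hD t ⟨ht.1, h⟩ htD.2.1).congr (splice_eventuallyEq_left u v h).symm
    · have h1 : ContinuousAt v (t - c) := hD' (t - c) ⟨by linarith, by linarith [ht.2]⟩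
        fun h' => htD.2.2 (Finset.mem_image.2 ⟨_, h', by ring⟩)
      refine (ContinuousAt.comp (f := fun s => s - c) h1
        (continuous_sub_right c).continuousAt).congr ?_
      filter_upwards [Ioi_mem_nhds h] with s hs
      exact (splice_of_ge u v (le_of_lt hs)).symm

/-- One-sided limits at every point of the compact interval bound the input. -/
theorem IsPiecewiseRightCont.exists_bound {m : ℕ} {u : ℝ → Vec m} {T : ℝ}
    (hu : IsPiecewiseRightCont u T) : ∃ M, ∀ t ∈ Icc 0 T, ‖u t‖ ≤ M := by
  refine isCompact_Icc.induction_on (p := fun s => ∃ M, ∀ t ∈ s, ‖u t‖ ≤ M) ⟨0, by simp⟩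
    (fun s t hst ⟨M, hM⟩ => ⟨M, fun r hr => hM r (hst hr)⟩)
    (fun s t ⟨M, hM⟩ ⟨M', hM'⟩ => ⟨max M M', fun r hr => hr.elim
      (fun h => (hM r h).trans (le_max_left _ _)) (fun h => (hM' r h).trans (le_max_right _ _))⟩)
    fun t ht => ?_
  have hl : ∃ M, ∀ᶠ s in 𝓝[<] t, s ∈ Icc 0 T → ‖u s‖ ≤ M := by
    rcases ht.1.eq_or_lt with h | h
    · refine ⟨0, mem_of_superset self_mem_nhdsWithin fun s hs hs' => ?_⟩
      exact absurd (mem_Iio.1 hs) (by rw [← h]; exact hs'.1.not_gt)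
    · obtain ⟨l, hl⟩ := hu.left_lim t ⟨h, ht.2⟩
      exact ⟨‖l‖ + 1, (hl.norm.eventually_le_const (lt_add_one _)).mono fun s hs _ => hs⟩
  have hr : ∃ M, ∀ᶠ s in 𝓝[≥] t, s ∈ Icc 0 T → ‖u s‖ ≤ M := by
    rcases ht.2.eq_or_lt with h | h
    · refine ⟨‖u t‖, mem_of_superset self_mem_nhdsWithin fun s hs hs' => ?_⟩
      rw [le_antisymm (hs'.2.trans h.ge) hs]
    · exact ⟨‖u t‖ + 1, ((hu.right_cont t ⟨ht.1, h⟩).norm.eventually_le_const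
        (lt_add_one _)).mono fun s hs _ => hs⟩
  obtain ⟨M, hM⟩ := hl
  obtain ⟨M', hM'⟩ := hr
  have h : ∀ᶠ s in 𝓝 t, s ∈ Icc 0 T → ‖u s‖ ≤ max M M' := by
    rw [← nhdsLT_sup_nhdsGE, eventually_sup]
    exact ⟨hM.mono fun s hs h => (hs h).trans (le_max_left _ _),
      hM'.mono fun s hs h => (hs h).trans (le_max_right _ _)⟩
  exact ⟨{s | s ∈ Icc 0 T → ‖u s‖ ≤ max M M'} ∩ Icc 0 T,
    inter_mem (mem_nhdsWithin_of_mem_nhds h) self_mem_nhdsWithin,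
    max M M', fun s hs => hs.1 hs.2⟩

theorem IsPiecewiseRightCont.aestronglyMeasurable {m : ℕ} {u : ℝ → Vec m} {T : ℝ}
    (hu : IsPiecewiseRightCont u T) :
    AEStronglyMeasurable u (volume.restrict (Ioc 0 T)) := by
  obtain ⟨D, hD⟩ := hu.finite_disc
  have h1 : ContinuousOn u (Ioo 0 T \ D) := fun t ht =>
    (hD t ht.1 ht.2).continuousWithinAt
  have h2 := h1.aestronglyMeasurable (μ := volume)
    (measurableSet_Ioo.diff D.finite_toSet.measurableSet)
  have h3 : (Ioo 0 T \ D : Set ℝ) =ᵐ[volume] Ioc 0 T :=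
    (sdiff_null_ae_eq_self (D.finite_toSet.measure_zero _)).trans Ioo_ae_eq_Ioc
  rwa [Measure.restrict_congr_set h3] at h2

theorem IsPiecewiseRightCont.intervalIntegrable_comp {m : ℕ} {u : ℝ → Vec m} {T : ℝ}
    (hu : IsPiecewiseRightCont u T) (hT : 0 ≤ T) {g : Vec m → ℝ} (hg : Continuous g) :
    IntervalIntegrable (fun t => g (u t)) volume 0 T := by
  obtain ⟨M, hM⟩ := hu.exists_bound
  obtain ⟨N, hN⟩ := (isCompact_closedBall (0 : Vec m) M).exists_bound_of_continuousOn
    hg.continuousOn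
  rw [intervalIntegrable_iff_integrableOn_Ioc_of_le hT]
  refine IntegrableOn.of_bound measure_Ioc_lt_top
    (hg.comp_aestronglyMeasurable hu.aestronglyMeasurable) N ?_
  filter_upwards [ae_restrict_mem measurableSet_Ioc] with t ht
  exact hN _ (by simpa using hM t (Ioc_subset_Icc_self ht))

theorem IsAdmissible.splice {m : ℕ} {U : Set (Vec m)} {u v : ℝ → Vec m} {c d : ℝ}
    (hu : IsAdmissible U u c) (hv : IsAdmissible U v d) :
    IsAdmissible U (splice c u v) (c + d) := by
  refine ⟨hu.1.splice hv.1, fun t ht => ?_⟩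
  rcases lt_or_ge t c with h | h
  · rw [splice_of_lt u v h]; exact hu.2 t ⟨ht.1, h.le⟩
  · rw [splice_of_ge u v h]; exact hv.2 _ ⟨by linarith, by linarith [ht.2]⟩

theorem IsAdmissible.shift {m : ℕ} {U : Set (Vec m)} {u : ℝ → Vec m} {T c : ℝ}
    (hu : IsAdmissible U u T) (hc : 0 ≤ c) : IsAdmissible U (fun s => u (s + c)) (T - c) :=
  ⟨hu.1.shift hc, fun t ht => hu.2 _ ⟨by linarith [ht.1], by linarith [ht.2]⟩⟩

/-! ### Solutions -/

theorem hasDerivWithinAt_comp_add_const {E : Type*} [NormedAddCommGroup E] [NormedSpace ℝ E]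
    {x : ℝ → E} {v : E} {t c : ℝ} (h : HasDerivWithinAt x v (Ici (t + c)) (t + c)) :
    HasDerivWithinAt (fun s => x (s + c)) v (Ici t) t := by
  have h1 : HasDerivWithinAt (fun s : ℝ => s + c) 1 (Ici t) t :=
    (hasDerivWithinAt_id t _).add_const c
  have h2 := HasDerivWithinAt.scomp (g₁ := x) (h := fun s : ℝ => s + c) t h h1
    (fun s hs => add_le_add_left (mem_Ici.1 hs) c)
  rwa [one_smul] at h2

section

variable {n m : ℕ} {f : Vec n → Vec m → Vec n} {u v : ℝ → Vec m} {x y : ℝ → Vec n} {T c d : ℝ}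

theorem IsSolutionOn.mono (hx : IsSolutionOn f u x T) {T' : ℝ} (h : T' ≤ T) :
    IsSolutionOn f u x T' :=
  ⟨hx.1.mono (Icc_subset_Icc_right h), fun t ht => hx.2 t ⟨ht.1, ht.2.trans_le h⟩⟩

theorem IsSolutionOn.congr_input (hx : IsSolutionOn f u x T) (h : EqOn u v (Ico 0 T)) :
    IsSolutionOn f v x T :=
  ⟨hx.1, fun t ht => by rw [← h ht]; exact hx.2 t ht⟩

theorem IsSolutionOn.shift (hx : IsSolutionOn f u x T) (hc : 0 ≤ c) :
    IsSolutionOn f (fun s => u (s + c)) (fun s => x (s + c)) (T - c) :=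
  ⟨hx.1.comp (continuous_add_const c).continuousOn
    fun t ht => ⟨by linarith [ht.1], by linarith [ht.2]⟩,
    fun t ht => hasDerivWithinAt_comp_add_const
      (hx.2 (t + c) ⟨by linarith [ht.1], by linarith [ht.2]⟩)⟩

theorem splice_eqOn_Icc (hxy : x c = y 0) : EqOn (splice c x y) x (Icc 0 c) := fun t ht => by
  rcases ht.2.eq_or_lt with h | h
  · rw [h, splice_of_ge x y le_rfl, sub_self, hxy]
  · exact splice_of_lt x y h

theorem IsSolutionOn.splice (hx : IsSolutionOn f u x c) (hy : IsSolutionOn f v y d)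
    (hc : 0 ≤ c) (hd : 0 ≤ d) (hxy : x c = y 0) :
    IsSolutionOn f (splice c u v) (splice c x y) (c + d) := by
  refine ⟨?_, fun t ht => ?_⟩
  · rw [← Icc_union_Icc_eq_Icc hc (by linarith : c ≤ c + d)]
    refine ContinuousOn.union_of_isClosed (hx.1.congr (splice_eqOn_Icc hxy)) ?_
      isClosed_Icc isClosed_Icc
    refine ContinuousOn.congr (f := fun s => y (s - c)) ?_ fun s hs => splice_of_ge x y hs.1
    exact hy.1.comp (continuous_sub_right c).continuousOn
      fun t ht => ⟨by linarith [ht.1], by linarith [ht.2]⟩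
  · rcases lt_or_ge t c with h | h
    · rw [splice_of_lt _ _ h, splice_of_lt _ _ h]
      exact (hx.2 t ⟨ht.1, h⟩).congr_of_eventuallyEq
        ((splice_eventuallyEq_left x y h).filter_mono nhdsWithin_le_nhds) (splice_of_lt _ _ h)
    · rw [splice_of_ge _ _ h, splice_of_ge _ _ h]
      refine HasDerivWithinAt.congr_of_eventuallyEq ?_
        (splice_eventuallyEq_right x y h) (by rw [splice_of_ge _ _ h, sub_eq_add_neg])
      exact hasDerivWithinAt_comp_add_const
        (hy.2 (t - c) ⟨by linarith, by linarith [ht.2]⟩)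

/-- The input is bounded, so `f(·, u(t))` is Lipschitz on bounded sets uniformly in `t`, which is
enough for uniqueness although `u` jumps. -/
theorem IsSolutionOn.unique (hf : ContDiff ℝ 2 (fun p : Vec n × Vec m => f p.1 p.2))
    (hx : IsSolutionOn f u x T) (hy : IsSolutionOn f u y T)
    (hu : ∃ M, ∀ t ∈ Icc 0 T, ‖u t‖ ≤ M) (h0 : x 0 = y 0) : EqOn x y (Icc 0 T) := by
  obtain ⟨M, hM⟩ := hu
  obtain ⟨R₁, hR₁⟩ := isCompact_Icc.exists_bound_of_continuousOn hx.1
  obtain ⟨R₂, hR₂⟩ := isCompact_Icc.exists_bound_of_continuousOn hy.1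
  set R := max R₁ R₂
  obtain ⟨L, hL⟩ := (hf.contDiffOn (s := Metric.closedBall (0 : Vec n) R ×ˢ
      Metric.closedBall (0 : Vec m) M)).exists_lipschitzOnWith (by norm_num)
    ((convex_closedBall _ _).prod (convex_closedBall _ _))
    ((isCompact_closedBall _ _).prod (isCompact_closedBall _ _))
  refine ODE_solution_unique_of_mem_Icc_right (K := L) (v := fun t z => f z (u t))
    (s := fun _ => Metric.closedBall (0 : Vec n) R) (fun t ht => ?_) hx.1 hx.2 (fun t ht => ?_)
    hy.1 hy.2 (fun t ht => ?_) h0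
  · have hut : u t ∈ Metric.closedBall (0 : Vec m) M := by
      simpa using hM t (Ico_subset_Icc_self ht)
    intro a ha b hb
    have h := hL (show (a, u t) ∈ _ from ⟨ha, hut⟩) (show (b, u t) ∈ _ from ⟨hb, hut⟩)
    simpa [Prod.edist_eq] using h
  · exact mem_closedBall_zero_iff.2
      ((hR₁ t (Ico_subset_Icc_self ht)).trans (le_max_left _ _))
  · exact mem_closedBall_zero_iff.2
      ((hR₂ t (Ico_subset_Icc_self ht)).trans (le_max_right _ _))

end

/-! ### The local controller on the terminal region -/

theorem exists_solution_of_hasCompactSupport {n : ℕ} {g : Vec n → Vec n} (hg : ContDiff ℝ 1 g)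
    (hsupp : HasCompactSupport g) (x₀ : Vec n) {T : ℝ} (hT : 0 ≤ T) :
    ∃ z : ℝ → Vec n, z 0 = x₀ ∧
      ∀ t ∈ Icc 0 T, HasDerivWithinAt z (g (z t)) (Icc 0 T) t := by
  obtain ⟨L, hL⟩ := hg.lipschitzWith_of_hasCompactSupport (𝕂 := ℝ) hsupp one_ne_zero
  obtain ⟨M, hM⟩ := hsupp.exists_bound_of_continuous hg.continuous
  have hM0 : 0 ≤ M := (norm_nonneg _).trans (hM 0)
  have hpl : IsPicardLindelof (fun _ => g) (tmin := 0) (tmax := T) ⟨0, left_mem_Icc.2 hT⟩ x₀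
      (⟨M, hM0⟩ * ⟨T, hT⟩) 0 ⟨M, hM0⟩ L :=
    .of_time_independent (fun x _ => hM x) hL.lipschitzOnWith
      (by change M * max (T - 0) (0 - 0) ≤ M * T - 0; simp [hT])
  exact hpl.exists_eq_forall_mem_Icc_hasDerivWithinAt₀

/-- The integrand `zᵀ W_x z + uᵀ W_u u` of the cost, along `z` and `u`. -/
noncomputable def stageCost {n m : ℕ} (Wx : Matrix (Fin n) (Fin n) ℝ)
    (Wu : Matrix (Fin m) (Fin m) ℝ) (z : ℝ → Vec n) (u : ℝ → Vec m) (t : ℝ) : ℝ :=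
  quad Wx (z t) + quad Wu (u t)

theorem intervalIntegrable_stageCost {n m : ℕ} (Wx : Matrix (Fin n) (Fin n) ℝ)
    (Wu : Matrix (Fin m) (Fin m) ℝ) {z : ℝ → Vec n} {u : ℝ → Vec m} {T : ℝ} (hT : 0 ≤ T)
    (hz : ContinuousOn z (Icc 0 T)) (hu : IsPiecewiseRightCont u T) :
    IntervalIntegrable (stageCost Wx Wu z u) volume 0 T :=
  (((continuous_quad Wx).comp_continuousOn hz).intervalIntegrable_of_Icc hT).add
    (hu.intervalIntegrable_comp hT (continuous_quad Wu))

/-- The assumptions on the system, the weights and the terminal ingredients on which the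
stability proof rests. -/
structure IsNMPCSetup {n m : ℕ} (f : Vec n → Vec m → Vec n) (U : Set (Vec m))
    (Wx : Matrix (Fin n) (Fin n) ℝ) (Wu : Matrix (Fin m) (Fin m) ℝ)
    (K : Matrix (Fin m) (Fin n) ℝ) (P ΔQ : Matrix (Fin n) (Fin n) ℝ) (α : ℝ) : Prop where
  smooth : ContDiff ℝ 2 (fun p : Vec n × Vec m => f p.1 p.2)
  growth : QuadraticInputGrowth f U
  posDef_Wx : Wx.PosDef
  posDef_Wu : Wu.PosDef
  design : LyapunovDesign f Wx Wu K P ΔQ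
  level : IsTerminalLevel f U K P ΔQ α

section

variable {n m : ℕ} {f : Vec n → Vec m → Vec n} {U : Set (Vec m)}
  {Wx : Matrix (Fin n) (Fin n) ℝ} {Wu : Matrix (Fin m) (Fin m) ℝ}
  {K : Matrix (Fin m) (Fin n) ℝ} {P ΔQ : Matrix (Fin n) (Fin n) ℝ} {α : ℝ}

theorem quad_Qstar (x : Vec n) :
    quad (Qstar Wx Wu K) x = quad Wx x + quad Wu (-mulV K x) := by
  rw [Qstar, add_quad, quad_conj, quad_neg]

theorem IsNMPCSetup.quad_Qstar_pos (h : IsNMPCSetup f U Wx Wu K P ΔQ α) {x : Vec n}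
    (hx : x ≠ 0) : 0 < quad (Qstar Wx Wu K) x := by
  rw [quad_Qstar]
  exact add_pos_of_pos_of_nonneg (quad_pos h.posDef_Wx hx) (quad_nonneg h.posDef_Wu _)

theorem IsNMPCSetup.mem_terminalRegion (h : IsNMPCSetup f U Wx Wu K P ΔQ α) {x : Vec n} :
    x ∈ terminalRegion U K P α ↔ quad P x ≤ α :=
  ⟨fun hx => hx.1, fun hx => ⟨hx, h.level.2.1 x hx⟩⟩

/-- On the terminal region `u = -K x` decreases `xᵀ P x` at least at the rate of the stage cost. -/
theorem IsNMPCSetup.two_inner_le (h : IsNMPCSetup f U Wx Wu K P ΔQ α) {x : Vec n}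
    (hx : quad P x ≤ α) :
    2 * inner ℝ x (mulV P (f x (-mulV K x))) ≤ -quad (Qstar Wx Wu K) x := by
  rw [h.design.two_inner_eq]
  linarith [h.level.2.2 x (h.mem_terminalRegion.2 hx)]

/-- The local controller keeps the state in the terminal region, and the terminal cost dominates
the cost it accumulates. -/
theorem IsNMPCSetup.exists_local_solution (h : IsNMPCSetup f U Wx Wu K P ΔQ α) {x₀ : Vec n}
    (hx₀ : quad P x₀ ≤ α) {T : ℝ} (hT : 0 ≤ T) :
    ∃ z : ℝ → Vec n, z 0 = x₀ ∧ IsAdmissible U (fun t => -mulV K (z t)) T ∧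
      IsSolutionOn f (fun t => -mulV K (z t)) z T ∧ quad P (z T) ≤ α ∧
      (∫ t in (0 : ℝ)..T, stageCost Wx Wu z (fun t => -mulV K (z t)) t) + quad P (z T)
        ≤ quad P x₀ := by
  have hP := h.design.posDef_P
  obtain ⟨c, hc, hcq⟩ := exists_mul_sq_le_quad hP
  -- `√(α / c) ≤ α / c + 1`
  set R : ℝ := α / c + 1
  have hR : 0 < R := by have := h.level.1; positivity
  have hball : ∀ x : Vec n, quad P x ≤ α → ‖x‖ ≤ R := fun x hx => by
    have h1 : ‖x‖ ^ 2 ≤ α / c := by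
      rw [le_div_iff₀ hc, mul_comm]; exact (hcq x).trans hx
    nlinarith [sq_nonneg (‖x‖ - 1), norm_nonneg x]
  -- Cutting the vector field off outside a ball around the terminal region makes it globally
  -- Lipschitz and bounded.
  let χ : ContDiffBump (0 : Vec n) := ⟨R, R + 1, hR, by linarith⟩
  have hgK : ContDiff ℝ 1 (fun x => f x (-mulV K x)) :=
    (h.smooth.of_le (by norm_num)).comp (contDiff_id.prodMk (mulVL K).contDiff.neg)
  obtain ⟨z, hz0, hz⟩ := exists_solution_of_hasCompactSupport
    (g := fun x => χ x • f x (-mulV K x)) (χ.contDiff.smul hgK) χ.hasCompactSupport.smul_right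
    x₀ hT
  have hzc : ContinuousOn z (Icc 0 T) := fun t ht => (hz t ht).continuousWithinAt
  have hz' : ∀ t ∈ Ico 0 T,
      HasDerivWithinAt z (χ (z t) • f (z t) (-mulV K (z t))) (Ici t) t := fun t ht =>
    (hz t (Ico_subset_Icc_self ht)).mono_of_mem_nhdsWithin
      (mem_of_superset (Ico_mem_nhdsGE ht.2) fun _ hs => ⟨ht.1.trans hs.1, hs.2.le⟩)
  have hχ : ∀ t, quad P (z t) ≤ α → χ (z t) = 1 := fun t ht =>
    χ.one_of_mem_closedBall (by simpa [χ] using hball _ ht)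
  -- On the boundary of the terminal region the derivative of `xᵀ P x` is negative.
  have hinv : ∀ t ∈ Icc 0 T, quad P (z t) ≤ α := by
    refine image_le_of_deriv_right_lt_deriv_boundary (B := fun _ => α) (B' := fun _ => 0)
      ((continuous_quad P).comp_continuousOn hzc)
      (fun t ht => hasDerivWithinAt_quad hP (hz' t ht))
      (by rw [Function.comp_apply, hz0]; exact hx₀)
      (fun _ => hasDerivAt_const _ _) (fun t _ ht => ?_)
    have hne : z t ≠ 0 := fun h0 => by
      rw [Function.comp_apply, h0, quad_zero] at ht; exact h.level.1.ne ht
    rw [hχ t ht.le, one_smul]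
    have := h.two_inner_le ht.le
    linarith [h.quad_Qstar_pos hne]
  have hsol : ∀ t ∈ Ico 0 T, HasDerivWithinAt z (f (z t) (-mulV K (z t))) (Ici t) t :=
    fun t ht => by
      have h1 := hz' t ht
      rwa [hχ t (hinv t (Ico_subset_Icc_self ht)), one_smul] at h1
  have huc : ContinuousOn (fun t => -mulV K (z t)) (Icc 0 T) :=
    ((continuous_mulV K).comp_continuousOn hzc).neg
  refine ⟨z, hz0, ⟨.of_continuousOn huc, fun t ht => h.level.2.1 _ (hinv t ht)⟩, ⟨hzc, hsol⟩,
    hinv T (right_mem_Icc.2 hT), ?_⟩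
  have hint : IntegrableOn (fun t => -stageCost Wx Wu z (fun t => -mulV K (z t)) t) (Icc 0 T) := by
    refine ContinuousOn.integrableOn_Icc ?_
    exact (((continuous_quad Wx).comp_continuousOn hzc).add
      ((continuous_quad Wu).comp_continuousOn huc)).neg
  have hle := sub_le_integral_of_hasDeriv_right_of_le hT
    ((continuous_quad P).comp_continuousOn hzc)
    (fun t ht => (hasDerivWithinAt_quad hP (hsol t ⟨ht.1.le, ht.2⟩)).mono Ioi_subset_Ici_self)
    hint (fun t ht => by
      rw [stageCost, ← quad_Qstar]
      exact h.two_inner_le (hinv t (Ioo_subset_Icc_self ht)))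
  rw [intervalIntegral.integral_neg] at hle
  simp only [Function.comp_apply, hz0] at hle
  linarith

/-! ### Feasibility and decrease of the optimal cost -/

/-- The optimal control problem with terminal cost `xᵀ P x` and terminal region
`{x | xᵀ P x ≤ α, -K x ∈ U}`. -/
abbrev nmpcProblem (f : Vec n → Vec m → Vec n) (U : Set (Vec m))
    (Wx : Matrix (Fin n) (Fin n) ℝ) (Wu : Matrix (Fin m) (Fin m) ℝ)
    (K : Matrix (Fin m) (Fin n) ℝ) (P : Matrix (Fin n) (Fin n) ℝ) (α Tp : ℝ) : OCP n m :=
  ⟨f, U, Wx, Wu, P, terminalRegion U K P α, Tp⟩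

variable {Tp : ℝ}

/-- On the terminal region the problem is feasible, with cost at most `xᵀ P x`. -/
theorem IsNMPCSetup.exists_feasible_of_quad_le (h : IsNMPCSetup f U Wx Wu K P ΔQ α)
    (hT : 0 ≤ Tp) {x₀ : Vec n} (hx₀ : quad P x₀ ≤ α) :
    ∃ u z, (nmpcProblem f U Wx Wu K P α Tp).IsFeasiblePair x₀ u z ∧
      (nmpcProblem f U Wx Wu K P α Tp).cost u z ≤ quad P x₀ := by
  obtain ⟨z, hz0, hadm, hsol, hT', hcost⟩ := h.exists_local_solution hx₀ hT
  exact ⟨_, z, ⟨hadm, hsol, hz0, h.mem_terminalRegion.2 hT'⟩, hcost⟩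

/-- Dropping the first piece of a feasible pair and appending the local controller gives a
feasible pair at the later state; its cost is smaller by at least the cost of the dropped
piece. -/
theorem IsNMPCSetup.exists_feasible_shift (h : IsNMPCSetup f U Wx Wu K P ΔQ α) {δ : ℝ}
    (hδ : 0 ≤ δ) (hδT : δ ≤ Tp) {x₀ : Vec n} {u : ℝ → Vec m} {z : ℝ → Vec n}
    (hp : (nmpcProblem f U Wx Wu K P α Tp).IsFeasiblePair x₀ u z) :
    ∃ v w, (nmpcProblem f U Wx Wu K P α Tp).IsFeasiblePair (z δ) v w ∧
      (nmpcProblem f U Wx Wu K P α Tp).cost v w +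
        ∫ t in (0 : ℝ)..δ, stageCost Wx Wu z u t ≤
      (nmpcProblem f U Wx Wu K P α Tp).cost u z := by
  obtain ⟨hadm, hsol, -, hend⟩ := hp
  dsimp only [nmpcProblem] at hadm hsol hend
  obtain ⟨y, hy0, hyadm, hysol, hyT, hycost⟩ :=
    h.exists_local_solution (h.mem_terminalRegion.1 hend) hδ
  set c := Tp - δ
  have hc : 0 ≤ c := sub_nonneg.2 hδT
  have hcT : c + δ = Tp := by simp [c]
  have hzy : (fun s => z (s + δ)) c = y 0 := by simp only [hcT, hy0]
  set ky : ℝ → Vec m := fun t => -mulV K (y t)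
  set v := splice c (fun s => u (s + δ)) ky
  set w := splice c (fun s => z (s + δ)) y
  have hv : IsAdmissible U v Tp := hcT ▸ (hadm.shift hδ).splice hyadm
  have hw : IsSolutionOn f v w Tp := by
    have := (hsol.shift hδ).splice hysol hc hδ hzy
    rwa [hcT] at this
  have hw0 : w 0 = z δ := by
    rw [show w 0 = _ from splice_eqOn_Icc (x := fun s => z (s + δ)) hzy (left_mem_Icc.2 hc)]; simp
  have hwT : w Tp = y δ := by
    rw [← hcT, add_comm]; exact splice_add c _ _ hδ
  have hTp : 0 ≤ Tp := hδ.trans hδT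
  refine ⟨v, w, ⟨hv, hw, hw0, ?_⟩, ?_⟩
  · change w Tp ∈ terminalRegion U K P α
    rw [hwT]; exact h.mem_terminalRegion.2 hyT
  have hi := intervalIntegrable_stageCost Wx Wu hTp hsol.1 hadm.1
  have hi' := intervalIntegrable_stageCost Wx Wu hTp hw.1 hv.1
  have hδm : δ ∈ uIcc 0 Tp := by rw [uIcc_of_le hTp]; exact ⟨hδ, hδT⟩
  have hcm : c ∈ uIcc 0 Tp := by rw [uIcc_of_le hTp]; exact ⟨hc, by linarith⟩
  have e1 := integral_add_adjacent_intervals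
    (hi.mono_set (uIcc_subset_uIcc_left hδm)) (hi.mono_set (uIcc_subset_uIcc_right hδm))
  have e2 := integral_add_adjacent_intervals
    (hi'.mono_set (uIcc_subset_uIcc_left hcm)) (hi'.mono_set (uIcc_subset_uIcc_right hcm))
  have e3 : ∫ t in (0 : ℝ)..c, stageCost Wx Wu w v t =
      ∫ t in δ..Tp, stageCost Wx Wu z u t := by
    have e := intervalIntegral.integral_comp_add_right (a := 0) (b := c)
      (stageCost Wx Wu z u) δ
    rw [zero_add, hcT] at e
    rw [← e]
    refine integral_congr_Ioo_of_le hc fun t ht => ?_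
    simp only [stageCost, v, w, splice_of_lt _ _ ht.2]
  have e4 : ∫ t in c..Tp, stageCost Wx Wu w v t =
      ∫ t in (0 : ℝ)..δ, stageCost Wx Wu y ky t := by
    have e := intervalIntegral.integral_comp_sub_right (a := c) (b := Tp)
      (stageCost Wx Wu y ky) c
    rw [sub_self, show Tp - c = δ by simp [c]] at e
    rw [← e]
    refine integral_congr fun t ht => ?_
    rw [uIcc_of_le (by linarith)] at ht
    simp only [stageCost, v, w, splice_of_ge _ _ ht.1]
  change (∫ t in (0 : ℝ)..Tp, stageCost Wx Wu w v t) + quad P (w Tp) + _ ≤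
    (∫ t in (0 : ℝ)..Tp, stageCost Wx Wu z u t) + quad P (z Tp)
  rw [hwT]
  linarith

end

/-! ### Trajectories of finite cost -/

/-- A curve of norm `≤ ε` at time `a` has to cross the shell `ε ≤ ‖x‖ ≤ 2ε` before its norm
reaches `2ε`. If its speed in the shell is at most `κ L`, this takes `∫ κ L ≥ ε`. -/
theorem norm_lt_two_mul_of_integral_lt {E : Type*} [NormedAddCommGroup E]
    [InnerProductSpace ℝ E] {x x' : ℝ → E} {L : ℝ → ℝ} {a b ε κ : ℝ} (hab : a ≤ b) (hε : 0 < ε)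
    (hκ : 0 ≤ κ) (hx : ContinuousOn x (Icc a b))
    (hx' : ∀ t ∈ Ico a b, HasDerivWithinAt x (x' t) (Ici t) t)
    (hL : ∀ t, 0 ≤ L t) (hint : IntervalIntegrable L volume a b)
    (hbound : ∀ t ∈ Ico a b, ε ≤ ‖x t‖ → ‖x t‖ ≤ 2 * ε → ‖x' t‖ ≤ κ * L t)
    (ha : ‖x a‖ ≤ ε) (hsmall : κ * ∫ t in a..b, L t < ε) : ‖x b‖ < 2 * ε := by
  by_contra! hb
  -- the first time `t₂` at which the norm is `2ε`
  have hc1 : IsCompact (Icc a b ∩ (fun t => ‖x t‖) ⁻¹' Ici (2 * ε)) :=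
    isCompact_Icc.of_isClosed_subset
      (hx.norm.preimage_isClosed_of_isClosed isClosed_Icc isClosed_Ici) inter_subset_left
  obtain ⟨t₂, ⟨ht₂, ht₂n⟩, hleast⟩ := hc1.exists_isLeast ⟨b, right_mem_Icc.2 hab, hb⟩
  -- the last time `t₁` before it at which the norm is `ε`
  have hx₂ := hx.mono (Icc_subset_Icc_right ht₂.2)
  have hc2 : IsCompact (Icc a t₂ ∩ (fun t => ‖x t‖) ⁻¹' Iic ε) :=
    isCompact_Icc.of_isClosed_subset
      (hx₂.norm.preimage_isClosed_of_isClosed isClosed_Icc isClosed_Iic) inter_subset_left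
  obtain ⟨t₁, ⟨ht₁, ht₁n⟩, hgreatest⟩ := hc2.exists_isGreatest ⟨a, left_mem_Icc.2 ht₂.1, ha⟩
  simp only [mem_preimage, mem_Ici, mem_Iic] at ht₂n ht₁n
  have hsub : Icc t₁ t₂ ⊆ Icc a b := Icc_subset_Icc ht₁.1 ht₂.2
  have hint' : IntervalIntegrable L volume t₁ t₂ := hint.mono_set (by
    rw [uIcc_of_le ht₁.2, uIcc_of_le hab]; exact hsub)
  set w := x t₂
  have hderiv := sub_le_integral_of_hasDeriv_right_of_le (g := fun t => inner ℝ w (x t))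
    (g' := fun t => inner ℝ w (x' t)) (φ := fun t => ‖w‖ * (κ * L t)) ht₁.2
    (continuousOn_const.inner (hx.mono hsub))
    (fun t ht => by
      have h := (hx' t ⟨ht₁.1.trans ht.1.le, ht.2.trans_le ht₂.2⟩).mono Ioi_subset_Ici_self
      simpa using (hasDerivWithinAt_const t _ w).inner ℝ h)
    ((intervalIntegrable_iff_integrableOn_Icc_of_le ht₁.2).1
      ((hint'.const_mul κ).const_mul ‖w‖))
    (fun t ht => by
      have htm : t ∈ Ico a b := ⟨ht₁.1.trans ht.1.le, ht.2.trans_le ht₂.2⟩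
      refine (real_inner_le_norm _ _).trans (mul_le_mul_of_nonneg_left (hbound t htm ?_ ?_)
        (norm_nonneg _))
      · by_contra! hlt
        exact ht.1.not_ge (hgreatest ⟨⟨htm.1, ht.2.le⟩, hlt.le⟩)
      · by_contra! hlt
        exact ht.2.not_ge (hleast ⟨Ico_subset_Icc_self htm, hlt.le⟩))
  rw [intervalIntegral.integral_const_mul, intervalIntegral.integral_const_mul,
    real_inner_self_eq_norm_sq] at hderiv
  have h1 : inner ℝ w (x t₁) ≤ ‖w‖ * ε :=
    (real_inner_le_norm _ _).trans (mul_le_mul_of_nonneg_left ht₁n (norm_nonneg _))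
  have h2 : ∫ t in t₁..t₂, L t ≤ ∫ t in a..b, L t :=
    integral_mono_interval ht₁.1 ht₁.2 ht₂.2 (.of_forall hL) hint
  have h3 := mul_le_mul_of_nonneg_left h2 hκ
  have h4 : ‖w‖ * (‖w‖ - ε) ≤ ‖w‖ * (κ * ∫ t in t₁..t₂, L t) := by linarith
  have h5 := le_of_mul_le_mul_left h4 (by linarith : 0 < ‖w‖)
  linarith

/-- `x` solves `dx/dt = f(x, u)` on `[0, ∞)` with `u` in `U`, and its stage cost is integrable
with total at most `B`. -/
structure IsFiniteCostTrajectory {n m : ℕ} (f : Vec n → Vec m → Vec n) (U : Set (Vec m))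
    (Wx : Matrix (Fin n) (Fin n) ℝ) (Wu : Matrix (Fin m) (Fin m) ℝ) (u : ℝ → Vec m)
    (x : ℝ → Vec n) (B : ℝ) : Prop where
  solution : ∀ T, IsSolutionOn f u x T
  mem_input : ∀ t, 0 ≤ t → u t ∈ U
  integrable : ∀ T, 0 ≤ T → IntervalIntegrable (stageCost Wx Wu x u) volume 0 T
  cost_le : ∀ T, 0 ≤ T → ∫ t in (0 : ℝ)..T, stageCost Wx Wu x u t ≤ B

section

variable {n m : ℕ} {f : Vec n → Vec m → Vec n} {U : Set (Vec m)}
  {Wx : Matrix (Fin n) (Fin n) ℝ} {Wu : Matrix (Fin m) (Fin m) ℝ}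

theorem stageCost_nonneg (hWx : Wx.PosDef) (hWu : Wu.PosDef) (x : ℝ → Vec n) (u : ℝ → Vec m)
    (t : ℝ) : 0 ≤ stageCost Wx Wu x u t :=
  add_nonneg (quad_nonneg hWx _) (quad_nonneg hWu _)

/-- In the shell `ε ≤ ‖x‖ ≤ 2ε` the dynamics are dominated by the stage cost: this is where
quadratic growth in the input is used. -/
theorem exists_norm_le_mul_stageCost (hg : QuadraticInputGrowth f U) (hWx : Wx.PosDef)
    (hWu : Wu.PosDef) {ε : ℝ} (hε : 0 < ε) :
    ∃ κ, 0 ≤ κ ∧ ∀ x : Vec n, ∀ u ∈ U, ε ≤ ‖x‖ → ‖x‖ ≤ 2 * ε →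
      ‖f x u‖ ≤ κ * (quad Wx x + quad Wu u) := by
  obtain ⟨C, hC⟩ := hg (2 * ε)
  obtain ⟨c, hc, hcx⟩ := exists_mul_sq_le_quad hWx
  obtain ⟨d, hd, hdu⟩ := exists_mul_sq_le_quad hWu
  refine ⟨max C 0 * ((c * ε ^ 2)⁻¹ + d⁻¹), by positivity, fun x u hu h1 h2 => ?_⟩
  have hq := quad_nonneg hWx x
  have hq' := quad_nonneg hWu u
  have e1 : 1 ≤ (c * ε ^ 2)⁻¹ * quad Wx x := by
    rw [inv_mul_eq_div, one_le_div (by positivity)]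
    refine le_trans ?_ (hcx x)
    gcongr
  have e2 : ‖u‖ ^ 2 ≤ d⁻¹ * quad Wu u := by
    rw [inv_mul_eq_div, le_div_iff₀ hd, mul_comm]; exact hdu u
  calc ‖f x u‖ ≤ C * (1 + ‖u‖ ^ 2) := hC x h2 u hu
    _ ≤ max C 0 * (1 + ‖u‖ ^ 2) := by gcongr; exact le_max_left _ _
    _ ≤ max C 0 * ((c * ε ^ 2)⁻¹ * quad Wx x + d⁻¹ * quad Wu u) := by gcongr
    _ ≤ max C 0 * (((c * ε ^ 2)⁻¹ + d⁻¹) * (quad Wx x + quad Wu u)) := by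
      gcongr
      have e3 : 0 ≤ (c * ε ^ 2)⁻¹ * quad Wu u := by positivity
      have e4 : 0 ≤ d⁻¹ * quad Wx x := by positivity
      linarith
    _ = _ := by ring

/-- `norm_lt_two_mul_of_integral_lt` for trajectories: too little remaining cost confines the
state. -/
theorem IsFiniteCostTrajectory.norm_lt {u : ℝ → Vec m} {x : ℝ → Vec n} {B : ℝ}
    (h : IsFiniteCostTrajectory f U Wx Wu u x B) (hWx : Wx.PosDef) (hWu : Wu.PosDef) {ε κ : ℝ}
    (hε : 0 < ε) (hκ : 0 ≤ κ)
    (hbound : ∀ x : Vec n, ∀ u ∈ U, ε ≤ ‖x‖ → ‖x‖ ≤ 2 * ε →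
      ‖f x u‖ ≤ κ * (quad Wx x + quad Wu u))
    {s t : ℝ} (hs : 0 ≤ s) (hst : s ≤ t) (hxs : ‖x s‖ ≤ ε)
    (hsmall : κ * ∫ τ in s..t, stageCost Wx Wu x u τ < ε) : ‖x t‖ < 2 * ε := by
  have hsol := h.solution t
  refine norm_lt_two_mul_of_integral_lt hst hε hκ (hsol.1.mono (Icc_subset_Icc_left hs))
    (fun τ hτ => hsol.2 τ ⟨hs.trans hτ.1, hτ.2⟩) (stageCost_nonneg hWx hWu x u)
    ((h.integrable t (hs.trans hst)).mono_set ?_)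
    (fun τ hτ => hbound _ _ (h.mem_input τ (hs.trans hτ.1))) hxs hsmall
  rw [uIcc_of_le hst, uIcc_of_le (hs.trans hst)]
  exact Icc_subset_Icc_left hs

theorem IsFiniteCostTrajectory.integral_sub {u : ℝ → Vec m} {x : ℝ → Vec n} {B : ℝ}
    (h : IsFiniteCostTrajectory f U Wx Wu u x B) {s t : ℝ} (hs : 0 ≤ s) (ht : 0 ≤ t) :
    ∫ τ in s..t, stageCost Wx Wu x u τ =
      (∫ τ in (0 : ℝ)..t, stageCost Wx Wu x u τ) - ∫ τ in (0 : ℝ)..s, stageCost Wx Wu x u τ :=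
  (integral_interval_sub_left (h.integrable t ht) (h.integrable s hs)).symm

/-- Finite cost forces the state to return to every ball around the origin at arbitrarily late
times; the remaining cost is then too small for it to leave a ball of twice the radius. -/
theorem IsFiniteCostTrajectory.tendsto_zero {u : ℝ → Vec m} {x : ℝ → Vec n} {B : ℝ}
    (h : IsFiniteCostTrajectory f U Wx Wu u x B) (hg : QuadraticInputGrowth f U)
    (hWx : Wx.PosDef) (hWu : Wu.PosDef) : Tendsto x atTop (𝓝 0) := by
  rw [Metric.tendsto_atTop]
  intro ε₀ hε₀
  obtain ⟨ε, hε, rfl⟩ : ∃ ε > 0, 2 * ε = ε₀ := ⟨ε₀ / 2, by linarith, by ring⟩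
  obtain ⟨κ, hκ, hbound⟩ := exists_norm_le_mul_stageCost (f := f) hg hWx hWu hε
  obtain ⟨c, hc, hcx⟩ := exists_mul_sq_le_quad hWx
  set F : ℝ → ℝ := fun t => ∫ τ in (0 : ℝ)..t, stageCost Wx Wu x u τ
  have hη : 0 < ε / (κ + 1) := by positivity
  have hbdd : BddAbove (F '' Ici 0) := ⟨B, by rintro _ ⟨t, ht, rfl⟩; exact h.cost_le t ht⟩
  -- The cost after time `T` is too small for crossing the shell.
  obtain ⟨_, ⟨T, hT, rfl⟩, hlt⟩ := exists_lt_of_lt_csSup (s := F '' Ici 0)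
    ⟨F 0, 0, self_mem_Ici, rfl⟩ (sub_lt_self (sSup (F '' Ici 0)) hη)
  rw [mem_Ici] at hT
  have htail : ∀ t, 0 ≤ t → F t - F T < ε / (κ + 1) := fun t ht => by
    have := le_csSup hbdd (mem_image_of_mem F (mem_Ici.2 ht))
    linarith
  have hret : ∃ s ≥ T, ‖x s‖ ≤ ε := by
    by_contra! hno
    -- By this time a state of norm at least `ε` has used up all of the remaining cost.
    set t := T + ε / (κ + 1) / (c * ε ^ 2)
    have hTt : T ≤ t := le_add_of_nonneg_right (by positivity)
    have ht : 0 ≤ t := hT.trans hTt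
    have hlow : ∫ _ in T..t, c * ε ^ 2 ≤ ∫ τ in T..t, stageCost Wx Wu x u τ := by
      refine integral_mono_on hTt intervalIntegrable_const ((h.integrable t ht).mono_set ?_)
        fun τ hτ => ?_
      · rw [uIcc_of_le hTt, uIcc_of_le ht]; exact Icc_subset_Icc_left hT
      · have h1 : c * ε ^ 2 ≤ c * ‖x τ‖ ^ 2 := by
          have := (hno τ hτ.1).le
          gcongr
        have h2 := hcx (x τ)
        have h3 := quad_nonneg hWu (u τ)
        rw [stageCost]; linarith
    rw [h.integral_sub hT ht, intervalIntegral.integral_const, smul_eq_mul] at hlow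
    have h4 : (t - T) * (c * ε ^ 2) = ε / (κ + 1) := by simp only [t]; field_simp; ring
    have h5 := htail t ht
    simp only [F] at h5
    linarith
  obtain ⟨s, hsT, hxs⟩ := hret
  have hs : 0 ≤ s := hT.trans hsT
  refine ⟨s, fun t hst => ?_⟩
  rw [dist_zero_right]
  refine h.norm_lt hWx hWu hε hκ hbound hs hst hxs ?_
  have h1 : ∫ τ in s..t, stageCost Wx Wu x u τ ≤ ε / (κ + 1) := by
    have h2 := integral_mono_interval (c := T) (d := t) hsT hst le_rfl
      (.of_forall (stageCost_nonneg hWx hWu x u)) ((h.integrable t (hs.trans hst)).mono_set (by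
        rw [uIcc_of_le (hsT.trans hst), uIcc_of_le (hs.trans hst)]
        exact Icc_subset_Icc_left hT))
    rw [h.integral_sub hT (hs.trans hst)] at h2
    exact h2.trans (htail t (hs.trans hst)).le
  calc κ * ∫ τ in s..t, stageCost Wx Wu x u τ ≤ κ * (ε / (κ + 1)) := by gcongr
    _ < ε := by
      rw [mul_div_assoc', div_lt_iff₀ (by positivity)]
      nlinarith

end

/-! ### The closed loop -/

theorem exists_sampling_index {δ : ℝ} (hδ : 0 < δ) {t : ℝ} (ht : 0 ≤ t) :
    ∃ k : ℕ, (k : ℝ) * δ ≤ t ∧ t < k * δ + δ := by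
  refine ⟨⌊t / δ⌋₊, ?_, ?_⟩
  · rw [← le_div_iff₀ hδ]; exact Nat.floor_le (by positivity)
  · have := Nat.lt_floor_add_one (t / δ)
    rw [div_lt_iff₀ hδ] at this
    linarith

section

variable {n m : ℕ} {f : Vec n → Vec m → Vec n} {U : Set (Vec m)}
  {Wx : Matrix (Fin n) (Fin n) ℝ} {Wu : Matrix (Fin m) (Fin m) ℝ}
  {K : Matrix (Fin m) (Fin n) ℝ} {P ΔQ : Matrix (Fin n) (Fin n) ℝ} {α : ℝ}
  {Tp δ : ℝ} {ctrl : Vec n → ℝ → Vec m}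

/-- If the input `v`, with predicted state `z`, is applied from time `a` on for a time `δ`, then
the state follows the prediction, up to and including time `a + δ`. -/
theorem eqOn_prediction (hf : ContDiff ℝ 2 (fun p : Vec n × Vec m => f p.1 p.2))
    (hδT : δ ≤ Tp) {a : ℝ} (ha : 0 ≤ a) {u v : ℝ → Vec m} {x z : ℝ → Vec n}
    (hx : IsSolutionOn f u x (a + δ)) (huv : ∀ s ∈ Ico 0 δ, u (a + s) = v s)
    (hv : IsAdmissible U v Tp) (hz : IsSolutionOn f v z Tp) (h0 : z 0 = x a) :
    EqOn (fun s => x (s + a)) z (Icc 0 δ) := by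
  have h1 := hx.shift ha
  rw [add_sub_cancel_left] at h1
  obtain ⟨M, hM⟩ := hv.1.exists_bound
  exact (h1.congr_input (v := v) fun s hs => by rw [add_comm]; exact huv s hs).unique hf
    (hz.mono hδT) ⟨M, fun t ht => hM t ⟨ht.1, ht.2.trans hδT⟩⟩ (by simp [h0])

/-- Along the closed loop the problem stays feasible at the sampling instants, and the cost
accumulated up to `kδ` plus the optimal cost at `kδ` is at most the cost of any feasible pair at
the initial state. -/
theorem IsNMPCSetup.closedLoop_invariant (h : IsNMPCSetup f U Wx Wu K P ΔQ α)
    (hδ : 0 < δ) (hδT : δ ≤ Tp)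
    (hctrl : (nmpcProblem f U Wx Wu K P α Tp).IsNMPCController ctrl)
    {u : ℝ → Vec m} {x : ℝ → Vec n}
    (hu : ∀ k : ℕ, ∀ s ∈ Ico 0 δ, u (k * δ + s) = ctrl (x (k * δ)) s)
    (hx : ∀ T, IsSolutionOn f u x T) {v : ℝ → Vec m} {w : ℝ → Vec n}
    (hvw : (nmpcProblem f U Wx Wu K P α Tp).IsFeasiblePair (x 0) v w) (k : ℕ) :
    IntervalIntegrable (stageCost Wx Wu x u) volume 0 (k * δ) ∧
    ∃ z, (nmpcProblem f U Wx Wu K P α Tp).IsFeasiblePair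
        (x (k * δ)) (ctrl (x (k * δ))) z ∧
      (∀ v' w', (nmpcProblem f U Wx Wu K P α Tp).IsFeasiblePair
          (x (k * δ)) v' w' →
        (nmpcProblem f U Wx Wu K P α Tp).cost (ctrl (x (k * δ))) z ≤
        (nmpcProblem f U Wx Wu K P α Tp).cost v' w') ∧
      (∫ t in (0 : ℝ)..k * δ, stageCost Wx Wu x u t) +
          (nmpcProblem f U Wx Wu K P α Tp).cost (ctrl (x (k * δ))) z ≤
        (nmpcProblem f U Wx Wu K P α Tp).cost v w := by
  induction k with
  | zero =>
    obtain ⟨z, hz, hopt⟩ := hctrl (x 0) ⟨v, w, hvw⟩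
    simp only [Nat.cast_zero, zero_mul, integral_same, zero_add]
    exact ⟨.refl, z, hz, hopt, hopt v w hvw⟩
  | succ k ih =>
    obtain ⟨hint, z, hz, -, hcost⟩ := ih
    set a : ℝ := k * δ
    have ha : 0 ≤ a := by positivity
    have hk : ((k + 1 : ℕ) : ℝ) * δ = a + δ := by push_cast; ring
    have hpred : EqOn (fun s => x (s + a)) z (Icc 0 δ) :=
      eqOn_prediction h.smooth hδT ha (hx _) (hu k) hz.1 hz.2.1 hz.2.2.1
    have hnext : x (a + δ) = z δ := by
      rw [add_comm]; exact hpred (right_mem_Icc.2 hδ.le)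
    obtain ⟨v', w', hvw', hdec⟩ := h.exists_feasible_shift hδ.le hδT hz
    rw [← hnext] at hvw'
    obtain ⟨z', hz', hopt'⟩ := hctrl (x (a + δ)) ⟨v', w', hvw'⟩
    have heq : EqOn (stageCost Wx Wu z (ctrl (x a))) (fun s => stageCost Wx Wu x u (s + a))
        (Ioo 0 δ) := fun s hs => by
      have e1 : x (s + a) = z s := hpred (Ioo_subset_Icc_self hs)
      have e2 : u (s + a) = ctrl (x a) s := by rw [add_comm]; exact hu k s ⟨hs.1.le, hs.2⟩
      simp only [stageCost, e1, e2]
    have hintz : IntervalIntegrable (stageCost Wx Wu z (ctrl (x a))) volume 0 δ :=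
      intervalIntegrable_stageCost Wx Wu hδ.le (hz.2.1.1.mono (Icc_subset_Icc_right hδT))
        (hz.1.1.mono hδT)
    have hintx : IntervalIntegrable (stageCost Wx Wu x u) volume a (a + δ) := by
      have h1 : IntervalIntegrable (fun s => stageCost Wx Wu x u (s + a)) volume 0 δ := by
        rw [intervalIntegrable_iff_integrableOn_Ioo_of_le hδ.le] at hintz ⊢
        exact hintz.congr_fun heq measurableSet_Ioo
      have h2 := h1.comp_sub_right a
      simpa [add_comm] using h2
    have hval : ∫ t in a..a + δ, stageCost Wx Wu x u t =
        ∫ t in (0 : ℝ)..δ, stageCost Wx Wu z (ctrl (x a)) t := by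
      rw [integral_congr_Ioo_of_le hδ.le heq, intervalIntegral.integral_comp_add_right,
        zero_add, add_comm]
    rw [hk]
    refine ⟨hint.trans hintx, z', hz', hopt', ?_⟩
    rw [← integral_add_adjacent_intervals hint hintx, hval]
    linarith [hopt' v' w' hvw']

theorem IsNMPCSetup.cost_nonneg (h : IsNMPCSetup f U Wx Wu K P ΔQ α) (hT : 0 ≤ Tp)
    (u : ℝ → Vec m) (z : ℝ → Vec n) :
    0 ≤ (nmpcProblem f U Wx Wu K P α Tp).cost u z :=
  add_nonneg (integral_nonneg hT fun t _ =>
    stageCost_nonneg h.posDef_Wx h.posDef_Wu z u t) (quad_nonneg h.design.posDef_P _)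

/-- The cost of a feasible pair at the initial state bounds the cost of the closed loop. -/
theorem IsNMPCSetup.exists_isFiniteCostTrajectory (h : IsNMPCSetup f U Wx Wu K P ΔQ α)
    (hδ : 0 < δ) (hδT : δ ≤ Tp)
    (hctrl : (nmpcProblem f U Wx Wu K P α Tp).IsNMPCController ctrl)
    {x₀ : Vec n} {x : ℝ → Vec n} (hcl : IsClosedLoop f ctrl δ x₀ x) {v : ℝ → Vec m}
    {w : ℝ → Vec n}
    (hvw : (nmpcProblem f U Wx Wu K P α Tp).IsFeasiblePair x₀ v w) :
    ∃ u, IsFiniteCostTrajectory f U Wx Wu u x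
      ((nmpcProblem f U Wx Wu K P α Tp).cost v w) := by
  obtain ⟨rfl, u, hu, hx⟩ := hcl
  have hinv := h.closedLoop_invariant hδ hδT hctrl hu hx hvw
  have hsub : ∀ {T : ℝ} {k : ℕ}, 0 ≤ T → T < k * δ + δ →
      uIcc 0 T ⊆ uIcc 0 (((k + 1 : ℕ) : ℝ) * δ) := fun hT hlt => by
    rw [uIcc_of_le hT, uIcc_of_le (by positivity)]
    exact Icc_subset_Icc_right (by push_cast; linarith)
  refine ⟨u, hx, fun t ht => ?_, fun T hT => ?_, fun T hT => ?_⟩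
  · obtain ⟨k, hk, hk'⟩ := exists_sampling_index hδ ht
    obtain ⟨-, z, hz, -⟩ := hinv k
    have h1 := hu k (t - k * δ) ⟨by linarith, by linarith⟩
    rw [add_sub_cancel] at h1
    rw [h1]
    exact hz.1.2 _ ⟨by linarith, (by linarith : t - k * δ ≤ δ).trans hδT⟩
  · obtain ⟨k, -, hk'⟩ := exists_sampling_index hδ hT
    exact (hinv (k + 1)).1.mono_set (hsub hT hk')
  · obtain ⟨k, -, hk'⟩ := exists_sampling_index hδ hT
    obtain ⟨hint, z, -, -, hcost⟩ := hinv (k + 1)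
    have h1 := integral_mono_interval (c := 0) (d := ((k + 1 : ℕ) : ℝ) * δ) le_rfl hT
      (by push_cast; linarith) (.of_forall (stageCost_nonneg h.posDef_Wx h.posDef_Wu x u)) hint
    have h2 := h.cost_nonneg (hδ.le.trans hδT) (ctrl (x (((k + 1 : ℕ) : ℝ) * δ))) z
    linarith

theorem IsNMPCSetup.stable (h : IsNMPCSetup f U Wx Wu K P ΔQ α)
    (hδ : 0 < δ) (hδT : δ ≤ Tp)
    (hctrl : (nmpcProblem f U Wx Wu K P α Tp).IsNMPCController ctrl)
    {ε₀ : ℝ} (hε₀ : 0 < ε₀) :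
    ∃ η > 0, ∀ x₀ : Vec n, ‖x₀‖ < η → ∀ x, IsClosedLoop f ctrl δ x₀ x →
      ∀ t, 0 ≤ t → ‖x t‖ < ε₀ := by
  obtain ⟨ε, hε, rfl⟩ : ∃ ε > 0, 2 * ε = ε₀ := ⟨ε₀ / 2, by linarith, by ring⟩
  obtain ⟨κ, hκ, hbound⟩ :=
    exists_norm_le_mul_stageCost (f := f) h.growth h.posDef_Wx h.posDef_Wu hε
  have hlim : Tendsto (quad P) (𝓝 0) (𝓝 0) := by
    simpa [quad_zero] using (continuous_quad P).tendsto 0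
  have hlim' : Tendsto (fun x => κ * quad P x) (𝓝 0) (𝓝 0) := by
    simpa using hlim.const_mul κ
  obtain ⟨η, hη, hball⟩ := Metric.eventually_nhds_iff.1
    ((hlim.eventually_lt_const h.level.1).and (hlim'.eventually_lt_const hε))
  refine ⟨min η ε, lt_min hη hε, fun x₀ hx₀ x hcl t ht => ?_⟩
  obtain ⟨h1, h2⟩ := hball (y := x₀) (by
    rw [dist_zero_right]; exact hx₀.trans_le (min_le_left _ _))
  obtain ⟨v, w, hvw, hcost⟩ := h.exists_feasible_of_quad_le (hδ.le.trans hδT) h1.le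
  obtain ⟨u, htraj⟩ := h.exists_isFiniteCostTrajectory hδ hδT hctrl hcl hvw
  refine htraj.norm_lt h.posDef_Wx h.posDef_Wu hε hκ hbound le_rfl ht ?_ ?_
  · rw [hcl.1]; exact (hx₀.trans_le (min_le_right _ _)).le
  · exact (mul_le_mul_of_nonneg_left ((htraj.cost_le t ht).trans hcost) hκ).trans_lt h2

/-- Chaining the first pieces of the optimal predictions gives a closed-loop trajectory. -/
theorem IsNMPCSetup.exists_closedLoop (h : IsNMPCSetup f U Wx Wu K P ΔQ α)
    (hδ : 0 < δ) (hδT : δ ≤ Tp)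
    (hctrl : (nmpcProblem f U Wx Wu K P α Tp).IsNMPCController ctrl)
    {x₀ : Vec n}
    (hx₀ : x₀ ∈ (nmpcProblem f U Wx Wu K P α Tp).feasibleSet) :
    ∃ x, IsClosedLoop f ctrl δ x₀ x := by
  choose! ζ hζ using hctrl
  -- `X k` is the state at the sampling instant `kδ`.
  let X : ℕ → Vec n := fun k => Nat.rec x₀ (fun _ y => ζ y δ) k
  have hXs : ∀ k, X (k + 1) = ζ (X k) δ := fun k => rfl
  have hX : ∀ k, X k ∈ (nmpcProblem f U Wx Wu K P α Tp).feasibleSet := by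
    intro k
    induction k with
    | zero => exact hx₀
    | succ k ih =>
      obtain ⟨v, w, hvw, -⟩ := h.exists_feasible_shift hδ.le hδT (hζ _ ih).1
      exact ⟨v, w, hvw⟩
  have hfeas := fun k => (hζ _ (hX k)).1
  let x : ℝ → Vec n := fun t => ζ (X ⌊t / δ⌋₊) (t - ⌊t / δ⌋₊ * δ)
  let u : ℝ → Vec m := fun t => ctrl (X ⌊t / δ⌋₊) (t - ⌊t / δ⌋₊ * δ)
  have hfloor : ∀ k : ℕ, ∀ s ∈ Ico 0 δ, ⌊((k : ℝ) * δ + s) / δ⌋₊ = k := fun k s hs => by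
    have hkδ : 0 ≤ (k : ℝ) * δ := by positivity
    rw [Nat.floor_eq_iff (div_nonneg (add_nonneg hkδ hs.1) hδ.le), le_div_iff₀ hδ,
      div_lt_iff₀ hδ]
    exact ⟨by linarith [hs.1], by linarith [hs.2]⟩
  have hxI : ∀ k : ℕ, ∀ s ∈ Ico 0 δ, x (k * δ + s) = ζ (X k) s := fun k s hs => by
    simp only [x, hfloor k s hs, add_sub_cancel_left]
  have huI : ∀ k : ℕ, ∀ s ∈ Ico 0 δ, u (k * δ + s) = ctrl (X k) s := fun k s hs => by
    simp only [u, hfloor k s hs, add_sub_cancel_left]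
  have hxX : ∀ k : ℕ, x (k * δ) = X k := fun k => by
    have h1 := hxI k 0 (left_mem_Ico.2 hδ)
    rw [add_zero] at h1
    rw [h1]; exact (hfeas k).2.2.1
  -- At the right end point the prediction from `X k` meets the one from `X (k + 1)`.
  have hxC : ∀ k : ℕ, EqOn x (fun t => ζ (X k) (t - k * δ)) (Icc (k * δ) (k * δ + δ)) :=
    fun k t ht => by
      rcases ht.2.eq_or_lt with he | hlt
      · have h1 := hxX (k + 1)
        rw [show ((k + 1 : ℕ) : ℝ) * δ = t by rw [he]; push_cast; ring, hXs] at h1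
        rw [h1]
        simp only [he, add_sub_cancel_left]
      · have h1 := hxI k (t - k * δ) ⟨by linarith [ht.1], by linarith⟩
        rwa [add_sub_cancel] at h1
  have hcont : ∀ k : ℕ, ContinuousOn x (Icc 0 (k * δ)) := by
    intro k
    induction k with
    | zero => simp
    | succ k ih =>
      have hkδ : 0 ≤ (k : ℝ) * δ := by positivity
      rw [show ((k + 1 : ℕ) : ℝ) * δ = k * δ + δ by push_cast; ring,
        ← Icc_union_Icc_eq_Icc hkδ (by linarith : (k : ℝ) * δ ≤ k * δ + δ)]
      refine ih.union_of_isClosed (ContinuousOn.congr ?_ (hxC k)) isClosed_Icc isClosed_Icc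
      exact (hfeas k).2.1.1.comp (continuous_sub_right _).continuousOn
        fun t ht => ⟨by linarith [ht.1], (by linarith [ht.2] : t - k * δ ≤ δ).trans hδT⟩
  refine ⟨x, by simpa using! hxX 0, u, fun k s hs => by rw [hxX, huI k s hs], fun T => ⟨?_, ?_⟩⟩
  · rcases lt_or_ge T 0 with hT | hT
    · rw [Icc_eq_empty hT.not_ge]; exact continuousOn_empty x
    · obtain ⟨k, -, hk⟩ := exists_sampling_index hδ hT
      exact (hcont (k + 1)).mono (Icc_subset_Icc_right (by push_cast; linarith))
  · intro t ht
    obtain ⟨k, hk, hk'⟩ := exists_sampling_index hδ ht.1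
    have hs : t + -(k * δ) ∈ Ico 0 δ := ⟨by linarith, by linarith⟩
    have e : (k : ℝ) * δ + (t + -(k * δ)) = t := by ring
    have h1 := (hfeas k).2.1.2 _ ⟨hs.1, hs.2.trans_le hδT⟩
    have h2 := hasDerivWithinAt_comp_add_const h1
    have e1 := hxI k _ hs
    have e2 := huI k _ hs
    rw [e] at e1 e2
    rw [e1, e2]
    refine h2.congr_of_eventuallyEq ?_ e1
    filter_upwards [Ico_mem_nhdsGE hk'] with τ hτ
    rw [← sub_eq_add_neg]
    exact hxC k ⟨hk.trans hτ.1, hτ.2.le⟩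

end

end QIHNMPC

theorem theorem1 {n m : ℕ} (f : QIHNMPC.Vec n → QIHNMPC.Vec m → QIHNMPC.Vec n)
    (U : Set (QIHNMPC.Vec m)) (X : Set (QIHNMPC.Vec n))
    (hsys : QIHNMPC.StandingAssumptions f U X)
    (hgrowth : QIHNMPC.QuadraticInputGrowth f U)
    (Wx : Matrix (Fin n) (Fin n) ℝ) (Wu : Matrix (Fin m) (Fin m) ℝ)
    (hWx : Wx.PosDef) (hWu : Wu.PosDef)
    (K : Matrix (Fin m) (Fin n) ℝ) (P ΔQ : Matrix (Fin n) (Fin n) ℝ)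
    (hdesign : QIHNMPC.IsArbitraryDesign f Wx Wu K P ΔQ ∨ QIHNMPC.IsLQRDesign f Wx Wu K P ΔQ)
    (Tp δ : ℝ) (hδ : 0 < δ) (hδT : δ ≤ Tp) :
    -- admissible terminal regions exist,
    (∃ α : ℝ, QIHNMPC.IsTerminalLevel f U K P ΔQ α) ∧
    -- and for each of them the closed loop is asymptotically stable on the feasible set
    ∀ α : ℝ, QIHNMPC.IsTerminalLevel f U K P ΔQ α →
      ∀ p : QIHNMPC.OCP n m,
        p = ⟨f, U, Wx, Wu, P, QIHNMPC.terminalRegion U K P α, Tp⟩ →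
        ∀ ctrl : QIHNMPC.Vec n → ℝ → QIHNMPC.Vec m, p.IsNMPCController ctrl →
          QIHNMPC.IsAsymptoticallyStable (QIHNMPC.IsClosedLoop f ctrl δ) p.feasibleSet ∧
          -- the problem stays feasible at every sampling instant
          ∀ x₀ ∈ p.feasibleSet, ∀ x, QIHNMPC.IsClosedLoop f ctrl δ x₀ x →
            ∀ k : ℕ, x (k * δ) ∈ p.feasibleSet := by
  have hdes := QIHNMPC.lyapunovDesign_of_design hdesign
  refine ⟨QIHNMPC.exists_isTerminalLevel hsys.smooth hsys.equilibrium hsys.zero_mem_interior K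
    hdes.posDef_P hdes.posDef_ΔQ, ?_⟩
  rintro α hα p rfl ctrl hctrl
  have h : QIHNMPC.IsNMPCSetup f U Wx Wu K P ΔQ α :=
    ⟨hsys.smooth, hgrowth, hWx, hWu, hdes, hα⟩
  refine ⟨⟨fun x₀ hx₀ => h.exists_closedLoop hδ hδT hctrl hx₀, ?_,
    fun ε hε => h.stable hδ hδT hctrl hε, ?_⟩, ?_⟩
  · have hev : ∀ᶠ x in 𝓝 (0 : QIHNMPC.Vec n), QIHNMPC.quad P x < α :=
      (QIHNMPC.continuous_quad P).continuousAt.eventually_lt_const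
        (by rw [QIHNMPC.quad_zero]; exact hα.1)
    filter_upwards [hev] with x hx
    obtain ⟨u, z, huz, -⟩ := h.exists_feasible_of_quad_le (hδ.le.trans hδT) hx.le
    exact ⟨u, z, huz⟩
  · rintro x₀ ⟨v, w, hvw⟩ x hcl
    obtain ⟨u, htraj⟩ := h.exists_isFiniteCostTrajectory hδ hδT hctrl hcl hvw
    exact htraj.tendsto_zero hgrowth hWx hWu
  · rintro x₀ ⟨v, w, hvw⟩ x ⟨rfl, u, hu, hx⟩ k
    obtain ⟨-, z, hz, -⟩ := h.closedLoop_invariant hδ hδT hctrl hu hx hvw k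
    exact ⟨_, z, hz⟩
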